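/- Let $k:\mathbb{Z}\to[0,\infty)$ be a kernel with $k\not\equiv 0$, $k(0)=0$, $k(-j)=k(j)$ and $|k|_1:=\sum_{j\in\mathbb{Z}}k(j)<\infty$, and let $Lu(x)=\sum_{y\in\mathbb{Z}}k(x-y)(u(y)-u(x))$ be the operator generated by $k$. Put $\Upsilon(r)=e^r-1-r$ and, for bounded $u:\mathbb{Z}\to\mathbb{R}$, \[ \Psi_\Upsilon(u)(x)=\sum_{y}k(x-y)\Upsilon(u(y)-u(x)),\qquad B_{\Upsilon'}(u,v)(x)=\sum_{y}k(x-y)\Upsilon'(u(y)-u(x))(v(y)-v(x)), \] \[ \Psi_{2,\Upsilon}(u)=\tfrac12\big(L\Psi_\Upsilon(u)-B_{\Upsilon'}(u,Lu)\big). \] A $CD$-function is a continuous function $F:[0,\infty)\to[0,\infty)$ with $F(0)=0$ such that $x\mapsto F(x)/x$ is strictly increasing on $(0,\infty)$ and $1/F$ is integrable at $\infty$. The operator $L$ satisfies $CD_\Upsilon(0,F)$ if $\Psi_{2,\Upsilon}(u)(x)\ge F(-Lu(x))$ for all bounded $u:\mathbb{Z}\to\mathbb{R}$ and all $x\in\mathbb{Z}$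 with $-Lu(x)\ge0$. The heat kernel $p_t(x,y)$ of $\partial_tu-Lu=0$ on $(0,\infty)\times\mathbb{Z}$ is, for each $y\in\mathbb{Z}$, the solution of \[ \partial_tp_t(x,y)=\sum_{z\in\mathbb{Z}}k(x-z)\big(p_t(z,y)-p_t(x,y)\big)\quad(t>0,\ x\in\mathbb{Z}),\qquad p_0(x,y)=\delta(x,y), \] that is continuous in $t$ at $t=0$ and bounded on $[0,T]\times\mathbb{Z}$ for every $T>0$. For $c,\delta>0$, $\gamma\ge2$ and $\tau_1,\tau_2\in\mathbb{R}$ put $t_*=\frac{\delta^{\gamma-1}}{2^\gamma c\,e^2}$ and, for $t>0$, \[ \Lambda(t)=\begin{cases} \frac{t}{\delta}\big(1-\log(2^\gamma c\,\delta^{1-\gamma}t)\big), & t\le t_*,\\ \frac{\log t}{c e^2}+\tau_1, & t>t_*,\ \gamma=2,\\ \frac{((\gamma-1)t)^{\frac{\gamma-2}{\gamma-1}}}{(ce^2)^{\frac1{\gamma-1}}(\gamma-2)}+\tau_2, & t>t_*,\ \gamma>2, \end{cases} \] and, for $t,\nu>0$, let $c(t,\nu)=\big(\frac{\gamma-2}{\gamma-1}\nu+t^{\frac{\gamma-2}{\gamma-1}}\big)^{\frac{\gamma-1}{\gamma-2}}$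 if $\gamma>2$ and $c(t,\nu)=e^\nu t$ if $\gamma=2$. Theorem. There are constants $\tau_i=\tau_i(c,\gamma,\delta)\in\mathbb{R}$ ($i=1,2$) and $C_0=C_0(c,\gamma,\delta)>0$, depending only on $c>0$, $\gamma\ge2$ and $\delta>0$, such that the following holds. Let $F$ be a $CD$-function with $F(x)\sim c_1x^\gamma$ as $x\to0$ and $F(x)\sim c_2e^{\delta x}$ as $x\to\infty$, where $\gamma\ge2$ and $\delta,c_1,c_2>0$. Then there is a constant $c=c(F)>0$ such that $\Lambda(t)>0$ for all $t>0$ and such that, for every kernel $k$ as above that has a finite $\alpha$-th moment $\sum_{j}k(j)|j|^\alpha<\infty$ for some $\alpha>0$ and whose operator $L$ satisfies $CD_\Upsilon(0,F)$, the heat kernel satisfies, for all $x,y\in\mathbb{Z}$ and $t>0$, the lower bound \[ \exp\Big(-\Big(\Lambda(t)+\frac{2|x-y|^2}{k(1)\,t}\Big)\Big)\le p_t(x,y)\qquad\text{if }k(1)>0, \] and the upper bound \[ p_t(x,y)\le\frac{\exp\big(C_0\nu+\frac{2}{|k|_1}\big)}{2\lfloor\sqrt{c(t,\nu)-t}\rfloor}\qquad\text{for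 every }\nu>0\text{ with }c(t,\nu)-t\ge1. \] -/

import Mathlib

open Filter Topology Asymptotics

noncomputable section

namespace LongRange

/-- Nontrivial, nonnegative, symmetric, summable kernels on `ℤ`, with the convention `k 0 = 0`. -/
structure IsKernel (k : ℤ → ℝ) : Prop where
  nonneg : ∀ j, 0 ≤ k j
  symm : ∀ j, k (-j) = k j
  summable : Summable k
  zero : k 0 = 0
  nontrivial : ∃ j, k j ≠ 0

/-- `|k|₁`. -/
def mass (k : ℤ → ℝ) : ℝ := ∑' j, k j

/-- The kernel `k` has finite `α`-th moment. -/
def HasFiniteMoment (k : ℤ → ℝ) (α : ℝ) : Prop :=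
  Summable fun j : ℤ => k j * |(j : ℝ)| ^ α

/-- The operator `L u(x) = ∑_y k(x - y) (u(y) - u(x))` generated by `k`. -/
def gen (k : ℤ → ℝ) (u : ℤ → ℝ) (x : ℤ) : ℝ :=
  ∑' y, k (x - y) * (u y - u x)

/-- `Υ(r) = e^r - 1 - r`. -/
def upsilon (r : ℝ) : ℝ := Real.exp r - 1 - r

/-- `Υ'(r) = e^r - 1`. -/
def upsilonPrime (r : ℝ) : ℝ := Real.exp r - 1

theorem hasDerivAt_upsilon (r : ℝ) : HasDerivAt upsilon (upsilonPrime r) r :=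
  ((Real.hasDerivAt_exp r).sub_const 1).sub (hasDerivAt_id r)

/-- `Ψ_H(u)(x) = ∑_y k(x - y) H(u(y) - u(x))`. -/
def psi (k : ℤ → ℝ) (H : ℝ → ℝ) (u : ℤ → ℝ) (x : ℤ) : ℝ :=
  ∑' y, k (x - y) * H (u y - u x)

/-- `B_H(u, v)(x) = ∑_y k(x - y) H(u(y) - u(x)) (v(y) - v(x))`. -/
def bForm (k : ℤ → ℝ) (H : ℝ → ℝ) (u v : ℤ → ℝ) (x : ℤ) : ℝ :=
  ∑' y, k (x - y) * H (u y - u x) * (v y - v x)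

/-- `Ψ_{2,Υ}(u) = (L Ψ_Υ(u) - B_{Υ'}(u, L u)) / 2`. -/
def psiTwo (k : ℤ → ℝ) (u : ℤ → ℝ) (x : ℤ) : ℝ :=
  (gen k (psi k upsilon u) x - bForm k upsilonPrime u (gen k u) x) / 2

/-- `CD`-functions `[0, ∞) → [0, ∞)`; only the values of `F` on `[0, ∞)` matter. -/
structure IsCDFunction (F : ℝ → ℝ) : Prop where
  nonneg : ∀ x, 0 ≤ x → 0 ≤ F x
  continuousOn : ContinuousOn F (Set.Ici 0)
  zero : F 0 = 0
  strictMonoOn : StrictMonoOn (fun x => F x / x) (Set.Ioi 0)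
  integrable : ∃ a : ℝ, 0 < a ∧ MeasureTheory.IntegrableOn (fun x => 1 / F x) (Set.Ioi a)

/-- The curvature-dimension condition `CD_Υ(0, F)` for the operator generated by `k`. -/
def CDUpsilon (k : ℤ → ℝ) (F : ℝ → ℝ) : Prop :=
  ∀ u : ℤ → ℝ, (∃ C, ∀ y, |u y| ≤ C) → ∀ x : ℤ, 0 ≤ -gen k u x → F (-gen k u x) ≤ psiTwo k u x

/-- `p` is the heat kernel of `∂ₜ u - L u = 0` on `(0, ∞) × ℤ`: for each `y`, the function
`(t, x) ↦ p t x y` is the solution with initial value `δ(·, y)` that is bounded on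
`[0, T] × ℤ` for all `T` (boundedness makes it unique). -/
structure IsHeatKernel (k : ℤ → ℝ) (p : ℝ → ℤ → ℤ → ℝ) : Prop where
  initial : ∀ x y, p 0 x y = if x = y then 1 else 0
  continuous_zero : ∀ x y, ContinuousWithinAt (fun t => p t x y) (Set.Ici 0) 0
  equation : ∀ t, 0 < t → ∀ x y,
    HasDerivAt (fun s => p s x y) (∑' z, k (x - z) * (p t z y - p t x y)) t
  bounded : ∀ y T, ∃ C, ∀ t, 0 ≤ t → t ≤ T → ∀ x, |p t x y| ≤ C

section Existence

open scoped BoundedContinuousFunction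

private theorem summable_gen {k : ℤ → ℝ} (hk : IsKernel k) (u : ℤ →ᵇ ℝ) (x : ℤ) :
    Summable fun y => k (x - y) * (u y - u x) := by
  have hs : Summable fun y => k (x - y) := (Equiv.subLeft x).summable_iff.2 hk.summable
  refine Summable.of_norm_bounded (hs.mul_right (2 * ‖u‖)) fun y => ?_
  rw [norm_mul, Real.norm_of_nonneg (hk.nonneg _)]
  refine mul_le_mul_of_nonneg_left ?_ (hk.nonneg _)
  have h1 := u.norm_coe_le_norm y
  have h2 := u.norm_coe_le_norm x
  linarith [norm_sub_le (u y) (u x)]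

private theorem norm_gen_le {k : ℤ → ℝ} (hk : IsKernel k) (u : ℤ →ᵇ ℝ) (x : ℤ) :
    ‖gen k u x‖ ≤ mass k * 2 * ‖u‖ := by
  have hs : Summable fun y => k (x - y) := (Equiv.subLeft x).summable_iff.2 hk.summable
  have hm : ∑' y, k (x - y) = mass k := (Equiv.subLeft x).tsum_eq k
  have h0 : HasSum (fun y => k (x - y) * (2 * ‖u‖)) (mass k * (2 * ‖u‖)) :=
    hm ▸ hs.hasSum.mul_right _
  rw [mul_assoc]
  refine tsum_of_norm_bounded h0 fun y => ?_
  rw [norm_mul, Real.norm_of_nonneg (hk.nonneg _)]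
  refine mul_le_mul_of_nonneg_left ?_ (hk.nonneg _)
  have h1 := u.norm_coe_le_norm y
  have h2 := u.norm_coe_le_norm x
  linarith [norm_sub_le (u y) (u x)]

private theorem exists_clm {k : ℤ → ℝ} (hk : IsKernel k) :
    ∃ A : (ℤ →ᵇ ℝ) →L[ℝ] (ℤ →ᵇ ℝ), ∀ u x, A u x = gen k u x := by
  let A0 : (ℤ →ᵇ ℝ) →ₗ[ℝ] (ℤ →ᵇ ℝ) :=
    { toFun := fun u => BoundedContinuousFunction.ofNormedAddCommGroupDiscrete (gen k u)
        (mass k * 2 * ‖u‖) (norm_gen_le hk u)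
      map_add' := fun u v => by
        ext x
        change gen k (⇑(u + v)) x = gen k u x + gen k v x
        simp only [gen]
        rw [← (summable_gen hk u x).tsum_add (summable_gen hk v x)]
        refine tsum_congr fun y => ?_
        simp only [BoundedContinuousFunction.coe_add, Pi.add_apply]
        ring
      map_smul' := fun c u => by
        ext x
        change gen k (⇑(c • u)) x = c * gen k u x
        simp only [gen]
        rw [← tsum_mul_left]
        refine tsum_congr fun y => ?_
        simp only [BoundedContinuousFunction.coe_smul, smul_eq_mul]
        ring }
  have hm : 0 ≤ mass k := tsum_nonneg hk.nonneg
  refine ⟨A0.mkContinuous (mass k * 2) fun u => ?_, fun u x => rfl⟩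
  exact (BoundedContinuousFunction.norm_le (by positivity)).2 (norm_gen_le hk u)

private theorem exists_flow {E : Type*} [NormedAddCommGroup E] [NormedSpace ℝ E] [CompleteSpace E]
    (A : E →L[ℝ] E) (d : E) : ∃ w : ℝ → E, w 0 = d ∧ ∀ t, HasDerivAt w (A (w t)) t := by
  refine ⟨fun t => NormedSpace.exp (t • A) d, by simp [NormedSpace.exp_zero], fun t => ?_⟩
  simpa using (hasDerivAt_exp_smul_const' A t).clm_apply (hasDerivAt_const t d)

/-- The heat kernel exists, for every kernel. -/
theorem exists_isHeatKernel {k : ℤ → ℝ} (hk : IsKernel k) : ∃ p, IsHeatKernel k p := by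
  obtain ⟨A, hA⟩ := exists_clm hk
  let d : ℤ → (ℤ →ᵇ ℝ) := fun y =>
    BoundedContinuousFunction.ofNormedAddCommGroupDiscrete (fun x => if x = y then (1 : ℝ) else 0) 1
      (fun x => by split_ifs <;> simp)
  choose w hw0 hw using fun y => exists_flow A (d y)
  have hd : ∀ (y x : ℤ) (t : ℝ), HasDerivAt (fun s : ℝ => w y s x) (gen k (w y t) x) t := by
    intro y x t
    have h2 := (BoundedContinuousFunction.evalCLM ℝ x).hasFDerivAt.comp_hasDerivAt t (hw y t)
    simpa [Function.comp_def, ← hA] using h2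
  refine ⟨fun t x y => w y t x, ?_, ?_, ?_, ?_⟩
  · intro x y
    simp [hw0, d]
  · intro x y
    exact (hd y x 0).continuousAt.continuousWithinAt
  · intro t _ x y
    exact hd y x t
  · intro y T
    have hc : Continuous (w y) := continuous_iff_continuousAt.2 fun t => (hw y t).continuousAt
    obtain ⟨C, hC⟩ := (isCompact_Icc (a := (0 : ℝ)) (b := T)).exists_bound_of_continuousOn
      hc.continuousOn
    exact ⟨C, fun t h0 hT x =>
      (BoundedContinuousFunction.norm_coe_le_norm _ x).trans (hC t ⟨h0, hT⟩)⟩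

end Existence

/-- `t_* = δ^(γ-1) / (2^γ c e²)`. -/
def tStar (c γ δ : ℝ) : ℝ := δ ^ (γ - 1) / (2 ^ γ * c * Real.exp 2)

/-- The function `Λ`, for `γ ≥ 2`. -/
def Lam (c γ δ τ₁ τ₂ t : ℝ) : ℝ :=
  if t ≤ tStar c γ δ then
    t / δ * (1 - Real.log (2 ^ γ * c * δ ^ (1 - γ) * t))
  else if γ = 2 then
    Real.log t / (c * Real.exp 2) + τ₁
  else
    ((γ - 1) * t) ^ ((γ - 2) / (γ - 1)) / ((c * Real.exp 2) ^ (1 / (γ - 1)) * (γ - 2)) + τ₂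

/-- The time `c(t, ν)`, for `γ ≥ 2`. -/
def cTime (γ t ν : ℝ) : ℝ :=
  if γ = 2 then Real.exp ν * t
  else ((γ - 2) / (γ - 1) * ν + t ^ ((γ - 2) / (γ - 1))) ^ ((γ - 1) / (γ - 2))

end LongRange

end

/-!
For a kernel satisfying `CD_Υ(0, F)`, the growth of `F` gives a constant `c` with
`F(x) ≥ c e² x^γ / 2` for all `x ≥ 0` and `F(x) ≥ 2^(γ-1) c δ^(-γ) e^(δ x)` for `x ≥ 2 / δ`
(`IsCDFunction.exists_dominates`). Both bounds of the theorem follow from these two minorants.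

*Lower bound.* Let `u = p_t(·, y) + ε` and `v = log u`; the shift by `ε` keeps `v` bounded, so that
the curvature-dimension condition applies to it. The heat equation gives `∂ₜ v = L v + Ψ_Υ(v)`, and
`w = -L v` satisfies
`∂ₜ w(x) = ∑_y k(x - y) e^(v(y) - v(x)) (w(y) - w(x)) - 2 Ψ_{2,Υ}(v)(x)`
(`IsKernel.gen_gen_add_psi`). By the maximum principle `nonpos_of_deriv_le_mul_bound`, `w` stays
below every function `ψ` with `ψ' ≥ -2 F(ψ)` and `ψ(0+) = ∞` (`IsLogHeat.neg_gen_le`). The two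
minorants of `F` provide two such functions, which are the derivatives of `Λ` on either side of
`t_*`; the additive constants `τ₁, τ₂` make `Λ` continuous. Hence `v + Λ` is nondecreasing in time,
with derivative at least `Ψ_Υ(v)`, and `Υ(r) ≥ r² / 2` turns this into a Riccati inequality for the
difference between two neighbours (`IsLogHeat.harnack_step`). Chaining `|x - y|` equal time steps,
with the starting time tending to `0`, where `p_0(y, y) = 1` and `Λ = 0`, and then `ε → 0`, gives
the bound.

*Upper bound.* The condition tested with a multiple of the indicator function of a point shows
that some jump rate `k(j)` is at least `e^(-2 / |k|₁)` up to a constant depending only on `c`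
(`CDUpsilon.exists_le_kernel`). The Fourier representation of the heat kernel, which holds by
uniqueness of bounded solutions, gives `p_t ≤ (t k(j))^(-1/2)` (`IsHeatKernel.le_one_div_sqrt`).
Together with `p_t ≤ 1` and `c(t, ν) - t ≤ (e^ν - 1) max(t, 1)` (`cTime_sub_le`) this is the stated
bound, since `D (e^ν - 1) ≤ e^((D + 1) ν)`.
-/

namespace LongRange

variable {k : ℤ → ℝ}

/-! ### Weighted sums against a kernel -/


theorem IsKernel.summable_sub (hk : IsKernel k) (x : ℤ) : Summable fun y => k (x - y) :=
  (Equiv.subLeft x).summable_iff.2 hk.summable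

theorem tsum_kernel_sub (k : ℤ → ℝ) (x : ℤ) : ∑' y, k (x - y) = mass k :=
  (Equiv.subLeft x).tsum_eq k

theorem IsKernel.mass_pos (hk : IsKernel k) : 0 < mass k := by
  obtain ⟨j, hj⟩ := hk.nontrivial
  exact hk.summable.tsum_pos hk.nonneg j (lt_of_le_of_ne (hk.nonneg j) (Ne.symm hj))

theorem IsKernel.summable_mul (hk : IsKernel k) {f : ℤ → ℝ} {C : ℝ} (hf : ∀ y, |f y| ≤ C)
    (x : ℤ) : Summable fun y => k (x - y) * f y := by
  refine Summable.of_norm_bounded ((hk.summable_sub x).mul_right C) fun y => ?_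
  rw [norm_mul, Real.norm_of_nonneg (hk.nonneg _)]
  exact mul_le_mul_of_nonneg_left (hf y) (hk.nonneg _)

theorem IsKernel.tsum_mul_le (hk : IsKernel k) {f : ℤ → ℝ} {C B : ℝ} (hf : ∀ y, |f y| ≤ C)
    (hB : ∀ y, f y ≤ B) (x : ℤ) : ∑' y, k (x - y) * f y ≤ mass k * B := by
  rw [← tsum_kernel_sub k x, ← tsum_mul_right]
  exact (hk.summable_mul hf x).tsum_le_tsum
    (fun y => mul_le_mul_of_nonneg_left (hB y) (hk.nonneg _)) ((hk.summable_sub x).mul_right B)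

theorem IsKernel.abs_tsum_mul_le (hk : IsKernel k) {f : ℤ → ℝ} {C : ℝ} (hf : ∀ y, |f y| ≤ C)
    (x : ℤ) : |∑' y, k (x - y) * f y| ≤ mass k * C := by
  refine abs_le'.2 ⟨hk.tsum_mul_le hf (fun y => (le_abs_self _).trans (hf y)) x, ?_⟩
  rw [← tsum_neg]
  have h := hk.tsum_mul_le (f := fun y => -f y) (C := C) (B := C)
    (fun y => by rw [abs_neg]; exact hf y) (fun y => (neg_le_abs _).trans (hf y)) x
  simpa only [mul_neg] using h

theorem abs_sub_le_two_mul {f : ℤ → ℝ} {C : ℝ} (hf : ∀ y, |f y| ≤ C) (x y : ℤ) :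
    |f y - f x| ≤ 2 * C :=
  (abs_sub _ _).trans (by linarith [hf x, hf y])

theorem IsKernel.abs_gen_le (hk : IsKernel k) {f : ℤ → ℝ} {C : ℝ} (hf : ∀ y, |f y| ≤ C)
    (x : ℤ) : |gen k f x| ≤ mass k * (2 * C) :=
  hk.abs_tsum_mul_le (abs_sub_le_two_mul hf x) x

/-! ### The maximum principle -/

/-- A maximum principle for bounded families `z t x` of functions of time. Where `z t x > 0`, the
time derivative is at most a constant multiple of any uniform bound on `z t`; this is what an
operator with bounded total jump rate provides, and no maximum over `x` has to be attained. -/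
theorem nonpos_of_deriv_le_mul_bound {ι : Type*} {z z' : ℝ → ι → ℝ} {s T C B : ℝ} (hC : 0 < C)
    (hcont : ∀ x, ContinuousOn (fun t => z t x) (Set.Icc s T))
    (hder : ∀ t ∈ Set.Ioo s T, ∀ x, HasDerivAt (fun t => z t x) (z' t x) t)
    (hbd : ∀ t ∈ Set.Icc s T, ∀ x, z t x ≤ B) (h0 : ∀ x, z s x ≤ 0)
    (hdiff : ∀ t ∈ Set.Ioo s T, ∀ x, 0 < z t x → ∀ K, (∀ y, z t y ≤ K) → z' t x ≤ C * K) :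
    ∀ t ∈ Set.Icc s T, ∀ x, z t x ≤ 0 := by
  have hstep : ∀ K : ℝ, 0 < K → (∀ t ∈ Set.Icc s T, ∀ x, z t x ≤ K * Real.exp (3 * C * (t - s))) →
      ∀ t ∈ Set.Icc s T, ∀ x, z t x ≤ K / 2 * Real.exp (3 * C * (t - s)) := by
    intro K hK hb t ht x
    refine le_of_forall_pos_le_add fun η hη => ?_
    rcases eq_or_lt_of_le ht.1 with rfl | hst
    · have := h0 x
      have h2 : 0 < K / 2 * Real.exp (3 * C * (s - s)) := by positivity
      linarith
    -- The comparison starts at a time `s'` slightly after `s`, since no derivative is known at `s`.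
    obtain ⟨s', hs', hz⟩ : ∃ s' ∈ Set.Ioo s t, z s' x < η := by
      have h1 : Tendsto (fun t => z t x) (𝓝[>] s) (𝓝 (z s x)) :=
        ((hcont x) s ⟨le_rfl, ht.1.trans ht.2⟩).mono_left
          (nhdsWithin_le_of_mem (mem_of_superset (Ioo_mem_nhdsGT (hst.trans_le ht.2))
            Set.Ioo_subset_Icc_self))
      have h2 := h1.eventually (gt_mem_nhds (lt_of_le_of_lt (h0 x) hη))
      obtain ⟨s', h3, h4⟩ := (h2.and (Ioo_mem_nhdsGT hst)).exists
      exact ⟨s', h4, h3⟩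
    have hB : ∀ τ, HasDerivAt (fun τ => K / 2 * Real.exp (3 * C * (τ - s)) + η)
        (K / 2 * (Real.exp (3 * C * (τ - s)) * (3 * C))) τ := by
      intro τ
      have h1 : HasDerivAt (fun τ => 3 * C * (τ - s)) (3 * C) τ := by
        simpa using ((hasDerivAt_id τ).sub_const s).const_mul (3 * C)
      exact (h1.exp.const_mul (K / 2)).add_const η
    have hsub : ∀ τ ∈ Set.Ico s' t, τ ∈ Set.Ioo s T := fun τ hτ =>
      ⟨hs'.1.trans_le hτ.1, hτ.2.trans_le ht.2⟩
    refine image_le_of_deriv_right_lt_deriv_boundary' (f := fun τ => z τ x) (f' := fun τ => z' τ x)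
      (a := s') (b := t) (B := fun τ => K / 2 * Real.exp (3 * C * (τ - s)) + η) ?_ ?_ ?_ ?_
      (fun τ _ => (hB τ).hasDerivWithinAt) ?_ ⟨hs'.2.le, le_rfl⟩
    · exact (hcont x).mono (Set.Icc_subset_Icc hs'.1.le ht.2)
    · exact fun τ hτ => (hder τ (hsub τ hτ) x).hasDerivWithinAt
    · have h2 : 0 < K / 2 * Real.exp (3 * C * (s' - s)) := by positivity
      linarith
    · exact fun τ _ => (hB τ).continuousAt.continuousWithinAt
    · intro τ hτ heq
      have hpos : 0 < K / 2 * Real.exp (3 * C * (τ - s)) := by positivity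
      have h3 := hdiff τ (hsub τ hτ) x (by rw [heq]; linarith) _
        (hb τ (Set.Ioo_subset_Icc_self (hsub τ hτ)))
      have h4 : 0 < C * K * Real.exp (3 * C * (τ - s)) := by positivity
      linarith
  have hiter : ∀ n : ℕ, ∀ t ∈ Set.Icc s T, ∀ x,
      z t x ≤ max B 1 * (1 / 2) ^ n * Real.exp (3 * C * (t - s)) := by
    intro n
    induction n with
    | zero =>
      intro t ht x
      have h1 : 1 ≤ Real.exp (3 * C * (t - s)) :=
        Real.one_le_exp (mul_nonneg (by positivity) (sub_nonneg.2 ht.1))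
      have h2 : 0 < max B 1 := lt_max_of_lt_right one_pos
      have h3 := (hbd t ht x).trans (le_max_left B 1)
      nlinarith
    | succ n ih =>
      intro t ht x
      have h2 : 0 < max B 1 := lt_max_of_lt_right one_pos
      refine (hstep _ (by positivity) ih t ht x).trans (le_of_eq ?_)
      rw [pow_succ]
      ring
  intro t ht x
  refine ge_of_tendsto' (x := atTop)
    (f := fun n : ℕ => max B 1 * (1 / 2) ^ n * Real.exp (3 * C * (t - s))) ?_
    fun n => hiter n t ht x
  have h := ((tendsto_pow_atTop_nhds_zero_of_lt_one (r := (1 / 2 : ℝ)) (by norm_num)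
    (by norm_num)).const_mul (max B 1)).mul_const (Real.exp (3 * C * (t - s)))
  simpa using h

/-- The maximum principle for bounded solutions of the heat equation. -/
theorem IsKernel.heat_nonpos (hk : IsKernel k) {u : ℝ → ℤ → ℝ} {T C : ℝ} (hT : 0 ≤ T)
    (hcont : ∀ x, ContinuousWithinAt (fun t => u t x) (Set.Ici 0) 0)
    (hder : ∀ t, 0 < t → ∀ x, HasDerivAt (fun t => u t x) (gen k (u t) x) t)
    (hbd : ∀ t ∈ Set.Icc 0 T, ∀ x, |u t x| ≤ C) (h0 : ∀ x, u 0 x ≤ 0) (x : ℤ) : u T x ≤ 0 := by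
  refine nonpos_of_deriv_le_mul_bound (z := u) (z' := fun t x => gen k (u t) x) (s := 0) (T := T)
    (C := mass k) (B := C) hk.mass_pos ?_ (fun t ht => hder t ht.1)
    (fun t ht x => (le_abs_self _).trans (hbd t ht x)) h0 ?_ T ⟨hT, le_rfl⟩ x
  · intro x t ht
    rcases eq_or_lt_of_le ht.1 with rfl | h
    · exact (hcont x).mono Set.Icc_subset_Ici_self
    · exact (hder t h x).continuousAt.continuousWithinAt
  · intro t ht x hx K hK
    exact hk.tsum_mul_le (abs_sub_le_two_mul (hbd t (Set.Ioo_subset_Icc_self ht)) x)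
      (fun y => by linarith [hK y]) x

/-! ### Nonnegativity, boundedness and uniqueness of the heat kernel -/

section HeatKernel

variable {p : ℝ → ℤ → ℤ → ℝ}

theorem IsHeatKernel.hasDerivAt_gen (hp : IsHeatKernel k p) {t : ℝ} (ht : 0 < t) (x y : ℤ) :
    HasDerivAt (fun s => p s x y) (gen k (fun z => p t z y) x) t :=
  hp.equation t ht x y

theorem gen_neg (k u : ℤ → ℝ) (x : ℤ) : gen k (fun y => -u y) x = -gen k u x := by
  simp only [gen, ← tsum_neg]
  exact tsum_congr fun y => by ring

theorem gen_add_const (k u : ℤ → ℝ) (a : ℝ) (x : ℤ) : gen k (fun y => u y + a) x = gen k u x := by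
  simp only [gen]
  exact tsum_congr fun y => by ring

theorem IsKernel.gen_sub (hk : IsKernel k) {u v : ℤ → ℝ} {C D : ℝ} (hu : ∀ y, |u y| ≤ C)
    (hv : ∀ y, |v y| ≤ D) (x : ℤ) :
    gen k (fun y => u y - v y) x = gen k u x - gen k v x := by
  simp only [gen]
  rw [← (hk.summable_mul (abs_sub_le_two_mul hu x) x).tsum_sub
    (hk.summable_mul (abs_sub_le_two_mul hv x) x)]
  exact tsum_congr fun y => by ring

theorem IsHeatKernel.nonneg (hk : IsKernel k) (hp : IsHeatKernel k p) {t : ℝ} (ht : 0 ≤ t)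
    (x y : ℤ) : 0 ≤ p t x y := by
  obtain ⟨C, hC⟩ := hp.bounded y t
  have := hk.heat_nonpos (u := fun t x => -p t x y) ht (fun x => (hp.continuous_zero x y).neg)
    (fun t ht x => by rw [gen_neg]; exact (hp.hasDerivAt_gen ht x y).neg)
    (fun t ht x => by rw [abs_neg]; exact hC t ht.1 ht.2 x)
    (fun x => by rw [hp.initial]; split_ifs <;> norm_num) x
  linarith

theorem IsHeatKernel.le_one (hk : IsKernel k) (hp : IsHeatKernel k p) {t : ℝ} (ht : 0 ≤ t)
    (x y : ℤ) : p t x y ≤ 1 := by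
  obtain ⟨C, hC⟩ := hp.bounded y t
  have := hk.heat_nonpos (u := fun t x => p t x y + -1) (C := C + 1) ht
    (fun x => (hp.continuous_zero x y).add_const _)
    (fun t ht x => by
      rw [gen_add_const k (fun x => p t x y)]
      exact (hp.hasDerivAt_gen ht x y).add_const _)
    (fun t ht x => (abs_add_le _ _).trans (by
      rw [abs_neg, abs_one]; linarith [hC t ht.1 ht.2 x]))
    (fun x => by rw [hp.initial]; split_ifs <;> norm_num) x
  linarith

theorem IsHeatKernel.le_of_isHeatKernel (hk : IsKernel k) {q : ℝ → ℤ → ℤ → ℝ}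
    (hp : IsHeatKernel k p) (hq : IsHeatKernel k q) {t : ℝ} (ht : 0 ≤ t) (x y : ℤ) :
    p t x y ≤ q t x y := by
  obtain ⟨C, hC⟩ := hp.bounded y t
  obtain ⟨D, hD⟩ := hq.bounded y t
  have habs : ∀ {r : ℝ → ℤ → ℤ → ℝ}, IsHeatKernel k r → ∀ {t : ℝ}, 0 < t → ∀ z, |r t z y| ≤ 1 :=
    fun hr t ht z => by rw [abs_of_nonneg (hr.nonneg hk ht.le z y)]; exact hr.le_one hk ht.le z y
  have := hk.heat_nonpos (u := fun t x => p t x y - q t x y) (C := C + D) ht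
    (fun x => (hp.continuous_zero x y).sub (hq.continuous_zero x y))
    (fun t ht x => by
      rw [hk.gen_sub (habs hp ht) (habs hq ht)]
      exact (hp.hasDerivAt_gen ht x y).sub (hq.hasDerivAt_gen ht x y))
    (fun t ht x => (abs_sub _ _).trans (add_le_add (hC t ht.1 ht.2 x) (hD t ht.1 ht.2 x)))
    (fun x => by rw [hp.initial, hq.initial, sub_self]) x
  linarith

end HeatKernel

/-! ### The Li–Yau estimate -/

theorem upsilon_nonneg (r : ℝ) : 0 ≤ upsilon r := by
  have := Real.add_one_le_exp r
  unfold upsilon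
  linarith

theorem abs_exp_le_of_abs_le {r R : ℝ} (h : |r| ≤ R) : |Real.exp r| ≤ Real.exp R := by
  rw [abs_of_pos (Real.exp_pos r)]
  exact Real.exp_le_exp.2 ((le_abs_self r).trans h)

theorem abs_upsilon_le_of_abs_le {r R : ℝ} (h : |r| ≤ R) : |upsilon r| ≤ Real.exp R := by
  have hR : 0 ≤ R := (abs_nonneg r).trans h
  rw [abs_of_nonneg (upsilon_nonneg r)]
  unfold upsilon
  have h1 := (le_abs_self _).trans (abs_exp_le_of_abs_le h)
  rcases le_total 0 r with hr | hr
  · linarith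
  · have := Real.exp_le_one_iff.2 hr
    have := Real.add_one_le_exp R
    have := neg_le_abs r
    linarith

theorem IsKernel.summable_upsilon (hk : IsKernel k) {v : ℤ → ℝ} {V : ℝ} (hv : ∀ y, |v y| ≤ V)
    (x : ℤ) : Summable fun y => k (x - y) * upsilon (v y - v x) :=
  hk.summable_mul (fun y => abs_upsilon_le_of_abs_le (abs_sub_le_two_mul hv x y)) x

theorem IsKernel.abs_psi_upsilon_le (hk : IsKernel k) {v : ℤ → ℝ} {V : ℝ} (hv : ∀ y, |v y| ≤ V)
    (x : ℤ) : |psi k upsilon v x| ≤ mass k * Real.exp (2 * V) :=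
  hk.abs_tsum_mul_le (fun y => abs_upsilon_le_of_abs_le (abs_sub_le_two_mul hv x y)) x

/-- The logarithmic form of the generator, `L u / u = L (log u) + Ψ_Υ (log u)`, written for
`u = exp v`. -/
theorem IsKernel.gen_exp_div (hk : IsKernel k) {v : ℤ → ℝ} {V : ℝ} (hv : ∀ y, |v y| ≤ V) (x : ℤ) :
    gen k (fun y => Real.exp (v y)) x / Real.exp (v x) = gen k v x + psi k upsilon v x := by
  rw [gen, gen, psi, ← (hk.summable_mul (abs_sub_le_two_mul hv x) x).tsum_add
    (hk.summable_upsilon hv x), ← tsum_div_const]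
  refine tsum_congr fun y => ?_
  rw [upsilon, Real.exp_sub]
  have := (Real.exp_pos (v x)).ne'
  field_simp
  ring

/-- Bochner-type identity: `L (L v + Ψ_Υ v)` is `2 Ψ_{2,Υ} v` plus the generator with jump rates
`k (x - y) exp (v y - v x)` applied to `L v`. -/
theorem IsKernel.gen_gen_add_psi (hk : IsKernel k) {v : ℤ → ℝ} {V : ℝ} (hv : ∀ y, |v y| ≤ V)
    (x : ℤ) : gen k (fun z => gen k v z + psi k upsilon v z) x = 2 * psiTwo k v x +
      ∑' y, k (x - y) * (Real.exp (v y - v x) * (gen k v y - gen k v x)) := by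
  have hL := abs_sub_le_two_mul (hk.abs_gen_le hv) x
  have hΨ := abs_sub_le_two_mul (hk.abs_psi_upsilon_le hv) x
  have hE : ∀ y, |Real.exp (v y - v x) * (gen k v y - gen k v x)| ≤
      Real.exp (2 * V) * (2 * (mass k * (2 * V))) := fun y => by
    rw [abs_mul]
    exact mul_le_mul (abs_exp_le_of_abs_le (abs_sub_le_two_mul hv x y)) (hL y) (abs_nonneg _)
      (Real.exp_pos _).le
  have hB : bForm k upsilonPrime v (gen k v) x =
      (∑' y, k (x - y) * (Real.exp (v y - v x) * (gen k v y - gen k v x))) -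
        ∑' y, k (x - y) * (gen k v y - gen k v x) := by
    rw [bForm, ← (hk.summable_mul hE x).tsum_sub (hk.summable_mul hL x)]
    refine tsum_congr fun y => ?_
    rw [upsilonPrime]
    ring
  have hS : gen k (fun z => gen k v z + psi k upsilon v z) x =
      (∑' y, k (x - y) * (gen k v y - gen k v x)) + gen k (psi k upsilon v) x := by
    have hΨx : gen k (psi k upsilon v) x =
        ∑' y, k (x - y) * (psi k upsilon v y - psi k upsilon v x) := rfl
    rw [hΨx, ← (hk.summable_mul hL x).tsum_add (hk.summable_mul hΨ x)]
    exact tsum_congr fun y => by ring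
  rw [hS, psiTwo, hB]
  ring

theorem IsKernel.hasDerivAt_gen (hk : IsKernel k) {v v' : ℝ → ℤ → ℝ} {V D : ℝ}
    (hv : ∀ t, 0 < t → ∀ x, |v t x| ≤ V) (hv' : ∀ t, 0 < t → ∀ x, |v' t x| ≤ D)
    (hder : ∀ t, 0 < t → ∀ x, HasDerivAt (fun t => v t x) (v' t x) t) {t : ℝ} (ht : 0 < t)
    (x : ℤ) : HasDerivAt (fun t => gen k (v t) x) (gen k (v' t) x) t := by
  refine hasDerivAt_tsum_of_isPreconnected (t := Set.Ioi 0) (y₀ := t) (y := t)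
    (g := fun y t => k (x - y) * (v t y - v t x)) (g' := fun y t => k (x - y) * (v' t y - v' t x))
    (u := fun y => k (x - y) * (2 * D)) ((hk.summable_sub x).mul_right _) isOpen_Ioi
    isPreconnected_Ioi ?_ ?_ ht (hk.summable_mul (abs_sub_le_two_mul (hv t ht) x) x) ht
  · exact fun y s hs => ((hder s hs y).sub (hder s hs x)).const_mul _
  · intro y s hs
    rw [norm_mul, Real.norm_of_nonneg (hk.nonneg _)]
    exact mul_le_mul_of_nonneg_left (abs_sub_le_two_mul (hv' s hs) x y) (hk.nonneg _)

theorem IsCDFunction.pos {F : ℝ → ℝ} (hF : IsCDFunction F) {x : ℝ} (hx : 0 < x) : 0 < F x := by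
  have h := hF.strictMonoOn (Set.mem_Ioi.2 (half_pos hx)) (Set.mem_Ioi.2 hx) (half_lt_self hx)
  have h1 : 0 ≤ F (x / 2) / (x / 2) := div_nonneg (hF.nonneg _ (half_pos hx).le) (half_pos hx).le
  exact (div_pos_iff_of_pos_right hx).1 (h1.trans_lt h)

theorem IsCDFunction.monotoneOn {F : ℝ → ℝ} (hF : IsCDFunction F) :
    MonotoneOn F (Set.Ici 0) := by
  intro x hx y hy hxy
  rcases eq_or_lt_of_le (Set.mem_Ici.1 hx) with rfl | hx0
  · rw [hF.zero]
    exact hF.nonneg y hy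
  · have hy0 := hx0.trans_le hxy
    have h := hF.strictMonoOn.monotoneOn (Set.mem_Ioi.2 hx0) (Set.mem_Ioi.2 hy0) hxy
    calc F x = F x / x * x := by field_simp
      _ ≤ F y / y * y := mul_le_mul h hxy hx0.le (div_nonneg (hF.nonneg y hy) hy0.le)
      _ = F y := by field_simp

/-- `v` is the logarithm of a positive solution of the heat equation, which is bounded and bounded
away from zero. -/
structure IsLogHeat (k : ℤ → ℝ) (V : ℝ) (v : ℝ → ℤ → ℝ) : Prop where
  bound : ∀ t, 0 < t → ∀ x, |v t x| ≤ V
  deriv : ∀ t, 0 < t → ∀ x,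
    HasDerivAt (fun t => v t x) (gen k (v t) x + psi k upsilon (v t) x) t

theorem IsHeatKernel.isLogHeat {p : ℝ → ℤ → ℤ → ℝ} (hk : IsKernel k) (hp : IsHeatKernel k p)
    {ε : ℝ} (hε : 0 < ε) (hε1 : ε ≤ 1) (y : ℤ) :
    IsLogHeat k (-Real.log ε + Real.log 2) fun t x => Real.log (p t x y + ε) := by
  have hbound : ∀ t, 0 < t → ∀ x, |Real.log (p t x y + ε)| ≤ -Real.log ε + Real.log 2 := by
    intro t ht x
    have h0 := hp.nonneg hk ht.le x y
    have h1 := hp.le_one hk ht.le x y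
    have h2 : Real.log ε ≤ Real.log (p t x y + ε) := Real.log_le_log hε (by linarith)
    have h3 : Real.log (p t x y + ε) ≤ Real.log 2 := Real.log_le_log (by linarith) (by linarith)
    have h4 : Real.log ε ≤ 0 := Real.log_nonpos hε.le hε1
    have h5 : 0 ≤ Real.log 2 := Real.log_nonneg (by norm_num)
    exact abs_le.2 ⟨by linarith, by linarith⟩
  refine ⟨hbound, fun t ht x => ?_⟩
  have hpos : ∀ z, 0 < p t z y + ε := fun z => by have := hp.nonneg hk ht.le z y; linarith
  have h := ((hp.hasDerivAt_gen ht x y).add_const ε).log (hpos x).ne'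
  convert h using 1
  rw [← hk.gen_exp_div (hbound t ht) x]
  simp only [Real.exp_log (hpos _)]
  rw [gen_add_const k fun z => p t z y]

/-- The Li–Yau estimate: under `CD_Υ(0, F)`, the function `-L v` is at most any function `ψ` with
`ψ' ≥ -2 F(ψ)` that blows up at time zero. -/
theorem IsLogHeat.neg_gen_le {F : ℝ → ℝ} {V : ℝ} {v : ℝ → ℤ → ℝ} (hk : IsKernel k)
    (hF : IsCDFunction F) (hCD : CDUpsilon k F) (hv : IsLogHeat k V v) {ψ ψ' : ℝ → ℝ} {T : ℝ}
    (hψ : ∀ t ∈ Set.Ioc 0 T, HasDerivAt ψ (ψ' t) t) (hψ0 : ∀ t ∈ Set.Ioc 0 T, 0 ≤ ψ t)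
    (hψF : ∀ t ∈ Set.Ioc 0 T, -2 * F (ψ t) ≤ ψ' t) (hlim : Tendsto ψ (𝓝[>] 0) atTop) (hT : 0 < T)
    (x : ℤ) : -gen k (v T) x ≤ ψ T := by
  obtain ⟨s, hs, hsψ⟩ : ∃ s ∈ Set.Ioo 0 T, mass k * (2 * V) ≤ ψ s :=
    (((hlim.eventually_ge_atTop (mass k * (2 * V))).and (Ioo_mem_nhdsGT hT)).exists).imp
      fun s h => ⟨h.2, h.1⟩
  have hsub : ∀ t ∈ Set.Icc s T, t ∈ Set.Ioc 0 T := fun t ht => ⟨hs.1.trans_le ht.1, ht.2⟩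
  have hV : ∀ t, 0 < t → ∀ x, |gen k (v t) x| ≤ mass k * (2 * V) :=
    fun t ht => hk.abs_gen_le (hv.bound t ht)
  have hder : ∀ t ∈ Set.Icc s T, ∀ x, HasDerivAt (fun t => -gen k (v t) x - ψ t)
      (-gen k (fun z => gen k (v t) z + psi k upsilon (v t) z) x - ψ' t) t := by
    intro t ht x
    have ht0 := (hsub t ht).1
    refine (hk.hasDerivAt_gen (v' := fun t z => gen k (v t) z + psi k upsilon (v t) z)
      (D := mass k * (2 * V) + mass k * Real.exp (2 * V)) hv.bound ?_ hv.deriv ht0 x).neg.sub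
      (hψ t (hsub t ht))
    exact fun t ht x => (abs_add_le _ _).trans
      (add_le_add (hV t ht x) (hk.abs_psi_upsilon_le (hv.bound t ht) x))
  have hmain := nonpos_of_deriv_le_mul_bound (z := fun t x => -gen k (v t) x - ψ t)
    (z' := fun t x => -gen k (fun z => gen k (v t) z + psi k upsilon (v t) z) x - ψ' t)
    (s := s) (T := T) (C := mass k * Real.exp (2 * V)) (B := mass k * (2 * V))
    (mul_pos hk.mass_pos (Real.exp_pos _))
    (fun x t ht => (hder t ht x).continuousAt.continuousWithinAt)
    (fun t ht => hder t (Set.Ioo_subset_Icc_self ht))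
    (fun t ht x => by
      have h1 := hV t (hsub t ht).1 x
      have h2 := hψ0 t (hsub t ht)
      linarith [neg_le_abs (gen k (v t) x)])
    (fun x => by
      have h1 := hV s hs.1 x
      linarith [neg_le_abs (gen k (v s) x)])
    ?_ T ⟨hs.2.le, le_rfl⟩ x
  · linarith
  intro t ht x hz K hK
  have htm := hsub t (Set.Ioo_subset_Icc_self ht)
  have hvt := hv.bound t htm.1
  have hψt := hψ0 t htm
  have hcd := hCD (v t) ⟨V, hvt⟩ x (by linarith)
  have hmono := hF.monotoneOn (Set.mem_Ici.2 hψt)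
    (Set.mem_Ici.2 (show 0 ≤ -gen k (v t) x by linarith)) (by linarith)
  have hdrift : ∑' y, k (x - y) * -(Real.exp (v t y - v t x) * (gen k (v t) y - gen k (v t) x)) ≤
      mass k * (Real.exp (2 * V) * K) := by
    refine hk.tsum_mul_le (C := Real.exp (2 * V) * (2 * (mass k * (2 * V)))) (fun y => ?_)
      (fun y => ?_) x
    · rw [abs_neg, abs_mul]
      exact mul_le_mul (abs_exp_le_of_abs_le (abs_sub_le_two_mul hvt x y))
        (abs_sub_le_two_mul (hV t htm.1) x y) (abs_nonneg _) (Real.exp_pos _).le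
    · have hK0 : 0 ≤ K := hz.le.trans (hK x)
      have h1 : -(gen k (v t) y - gen k (v t) x) ≤ K := by linarith [hK y]
      have h2 := (le_abs_self _).trans (abs_exp_le_of_abs_le (abs_sub_le_two_mul hvt x y))
      calc -(Real.exp (v t y - v t x) * (gen k (v t) y - gen k (v t) x))
          = Real.exp (v t y - v t x) * -(gen k (v t) y - gen k (v t) x) := by ring
        _ ≤ Real.exp (v t y - v t x) * K := mul_le_mul_of_nonneg_left h1 (Real.exp_pos _).le
        _ ≤ Real.exp (2 * V) * K := mul_le_mul_of_nonneg_right h2 hK0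
  simp only [mul_neg, tsum_neg] at hdrift
  have hODE := hψF t htm
  rw [hk.gen_gen_add_psi hvt x]
  linarith

/-! ### The Harnack inequality along chains of neighbours -/

theorem sq_div_two_le_upsilon {r : ℝ} (hr : 0 ≤ r) : r ^ 2 / 2 ≤ upsilon r := by
  have := Real.quadratic_le_exp_of_nonneg hr
  unfold upsilon
  linarith

theorem IsKernel.le_psi_upsilon (hk : IsKernel k) {v : ℤ → ℝ} {V : ℝ} (hv : ∀ y, |v y| ≤ V)
    (x y : ℤ) : k (x - y) * upsilon (v y - v x) ≤ psi k upsilon v x :=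
  (hk.summable_upsilon hv x).le_tsum y fun _ _ => mul_nonneg (hk.nonneg _) (upsilon_nonneg _)

/-- `Λ` is a continuous primitive, in the sense of right derivatives, of an upper bound for the
function `-L v` on positive times. -/
structure IsLiYauPrimitive (k : ℤ → ℝ) (v : ℝ → ℤ → ℝ) (Λ ψ : ℝ → ℝ) : Prop where
  cont : ContinuousOn Λ (Set.Ioi 0)
  deriv : ∀ t, 0 < t → HasDerivWithinAt Λ (ψ t) (Set.Ici t) t
  le : ∀ t, 0 < t → ∀ x, -gen k (v t) x ≤ ψ t

section Harnack

variable {V : ℝ} {v : ℝ → ℤ → ℝ} {Λ ψ : ℝ → ℝ}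

theorem IsLogHeat.add_continuousOn (hv : IsLogHeat k V v) (hΛ : IsLiYauPrimitive k v Λ ψ) (x : ℤ) :
    ContinuousOn (fun t => v t x + Λ t) (Set.Ioi 0) :=
  fun t ht => (hv.deriv t ht x).continuousAt.continuousWithinAt.add (hΛ.cont t ht)

theorem IsLogHeat.add_hasDerivWithinAt (hv : IsLogHeat k V v) (hΛ : IsLiYauPrimitive k v Λ ψ)
    {t : ℝ} (ht : 0 < t) (x : ℤ) : HasDerivWithinAt (fun t => v t x + Λ t)
      (gen k (v t) x + psi k upsilon (v t) x + ψ t) (Set.Ici t) t :=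
  (hv.deriv t ht x).hasDerivWithinAt.add (hΛ.deriv t ht)

theorem IsLogHeat.add_mono (hk : IsKernel k) (hv : IsLogHeat k V v)
    (hΛ : IsLiYauPrimitive k v Λ ψ) {s t : ℝ} (hs : 0 < s) (hst : s ≤ t) (x : ℤ) :
    v s x + Λ s ≤ v t x + Λ t := by
  refine image_le_of_deriv_right_le_deriv_boundary (f := fun _ => v s x + Λ s) (f' := fun _ => 0)
    (B := fun t => v t x + Λ t) continuousOn_const
    (fun τ _ => hasDerivWithinAt_const _ _ _) le_rfl
    ((hv.add_continuousOn hΛ x).mono fun τ hτ => hs.trans_le hτ.1)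
    (fun τ hτ => hv.add_hasDerivWithinAt hΛ (hs.trans_le hτ.1) x) (fun τ hτ => ?_) ⟨hst, le_rfl⟩
  have hτ0 := hs.trans_le hτ.1
  have h1 : 0 ≤ psi k upsilon (v τ) x :=
    tsum_nonneg fun y => mul_nonneg (hk.nonneg _) (upsilon_nonneg _)
  linarith [hΛ.le τ hτ0 x]

/-- One step of the Harnack inequality. With `a = v s x + Λ s`, the difference
`a - (v τ y + Λ τ)` satisfies the Riccati inequality `G' ≤ -(k (y - x) / 2) G²` as long as it is
positive, and hence drops below `2 / (k (y - x) d)` after time `d`. -/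
theorem IsLogHeat.harnack_step (hk : IsKernel k) (hv : IsLogHeat k V v)
    (hΛ : IsLiYauPrimitive k v Λ ψ) {x y : ℤ} (hxy : 0 < k (y - x)) {s d : ℝ} (hs : 0 < s)
    (hd : 0 < d) :
    v s x + Λ s - 2 / (k (y - x) * d) ≤ v (s + d) y + Λ (s + d) := by
  by_contra! hcon
  set a := v s x + Λ s with ha
  set A := 2 / (k (y - x) * d) with hA
  have hA0 : 0 < A := by positivity
  have hG : ∀ τ ∈ Set.Icc s (s + d), A < a - (v τ y + Λ τ) := fun τ hτ => by
    have := hv.add_mono hk hΛ (hs.trans_le hτ.1) hτ.2 y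
    linarith
  have hle := image_le_of_deriv_right_le_deriv_boundary
    (f := fun τ => k (y - x) / 2 * (τ - s)) (f' := fun _ => k (y - x) / 2)
    (a := s) (b := s + d) (B := fun τ => (a - (v τ y + Λ τ))⁻¹)
    (B' := fun τ => -(-(gen k (v τ) y + psi k upsilon (v τ) y + ψ τ)) /
      (a - (v τ y + Λ τ)) ^ 2)
    (by fun_prop)
    (fun τ _ => by
      simpa using (((hasDerivAt_id τ).sub_const s).const_mul (k (y - x) / 2)).hasDerivWithinAt)
    (by
      have := hG s ⟨le_rfl, by linarith⟩
      rw [sub_self, mul_zero]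
      exact inv_nonneg.2 (by linarith))
    ((continuousOn_const.sub ((hv.add_continuousOn hΛ y).mono fun τ hτ => hs.trans_le hτ.1)).inv₀
      fun τ hτ => (hA0.trans (hG τ hτ)).ne')
    (fun τ hτ => by
      have h := (hv.add_hasDerivWithinAt hΛ (hs.trans_le hτ.1) y).const_sub a
      exact h.fun_inv (hA0.trans (hG τ ⟨hτ.1, hτ.2.le⟩)).ne')
    (fun τ hτ => ?_) (x := s + d) ⟨by linarith, le_rfl⟩
  · have h1 := hG (s + d) ⟨by linarith, le_rfl⟩
    have h2 : (a - (v (s + d) y + Λ (s + d)))⁻¹ < A⁻¹ := inv_strictAnti₀ hA0 h1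
    have h3 : A⁻¹ = k (y - x) / 2 * (s + d - s) := by
      rw [hA, inv_div]
      ring
    simp only [← h3] at hle
    linarith
  · have hτ0 := hs.trans_le hτ.1
    have hGτ := hG τ ⟨hτ.1, hτ.2.le⟩
    have h1 := hk.le_psi_upsilon (hv.bound τ hτ0) y x
    have h2 : a - (v τ y + Λ τ) ≤ v τ x - v τ y := by
      have := hv.add_mono hk hΛ hs hτ.1 x
      linarith
    have h3 := sq_div_two_le_upsilon ((hA0.trans hGτ).le.trans h2)
    have h4 : (a - (v τ y + Λ τ)) ^ 2 ≤ (v τ x - v τ y) ^ 2 :=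
      pow_le_pow_left₀ (hA0.trans hGτ).le h2 2
    have h5 := mul_le_mul_of_nonneg_left ((div_le_div_of_nonneg_right h4 two_pos.le).trans h3)
      hxy.le
    rw [neg_neg, le_div_iff₀ (pow_pos (hA0.trans hGτ) 2)]
    linarith [hΛ.le τ hτ0 y]

theorem IsLogHeat.harnack_chain (hk : IsKernel k) (hv : IsLogHeat k V v)
    (hΛ : IsLiYauPrimitive k v Λ ψ) {e : ℤ} (he : 0 < k e) {d : ℝ} (hd : 0 < d) (n : ℕ) {s : ℝ}
    (hs : 0 < s) (x : ℤ) :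
    v s x + Λ s - n * (2 / (k e * d)) ≤ v (s + n * d) (x + n * e) + Λ (s + n * d) := by
  induction n with
  | zero => simp
  | succ n ih =>
    have h := hv.harnack_step hk hΛ (x := x + n * e) (y := x + (n + 1 : ℕ) * e) (s := s + n * d)
      (d := d) (by convert he using 2; push_cast; ring) (by positivity) hd
    have h1 : x + (n + 1 : ℕ) * e - (x + n * e) = e := by push_cast; ring
    have h2 : s + n * d + d = s + (n + 1 : ℕ) * d := by push_cast; ring
    rw [h1, h2] at h
    push_cast at h ⊢
    linarith

theorem IsLogHeat.harnack (hk : IsKernel k) (hv : IsLogHeat k V v)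
    (hΛ : IsLiYauPrimitive k v Λ ψ) (h1 : 0 < k 1) {s t : ℝ} (hs : 0 < s) (hst : s < t)
    (x y : ℤ) :
    v s y + Λ s - 2 * |(x : ℝ) - y| ^ 2 / (k 1 * (t - s)) ≤ v t x + Λ t := by
  obtain ⟨e, he, n, hn⟩ : ∃ e : ℤ, (k e = k 1 ∧ |e| = 1) ∧ ∃ n : ℕ, x = y + n * e := by
    rcases le_total y x with h | h
    · exact ⟨1, ⟨rfl, by norm_num⟩, (x - y).toNat, by rw [Int.toNat_of_nonneg (by omega)]; ring⟩
    · exact ⟨-1, ⟨hk.symm 1, by norm_num⟩, (y - x).toNat,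
        by rw [Int.toNat_of_nonneg (by omega)]; ring⟩
  have hdist : |(x : ℝ) - y| = n := by
    have h : |((x - y : ℤ) : ℝ)| = ((n : ℤ) : ℝ) := by
      rw [← Int.cast_abs, hn, add_sub_cancel_left, abs_mul, he.2, mul_one, Nat.abs_cast]
    simpa using h
  rw [hdist]
  rcases Nat.eq_zero_or_pos n with h0 | hpos
  · subst h0
    have := hv.add_mono hk hΛ hs hst.le y
    simpa [hn] using this
  · have hn0 : (0 : ℝ) < n := Nat.cast_pos.2 hpos
    have hts : 0 < t - s := sub_pos.2 hst
    have h := hv.harnack_chain hk hΛ (he.1 ▸ h1 : 0 < k e) (div_pos hts hn0) n hs y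
    rw [← hn, he.1, mul_div_cancel₀ _ hn0.ne', add_sub_cancel] at h
    have heq : (n : ℝ) * (2 / (k 1 * ((t - s) / n))) = 2 * (n : ℝ) ^ 2 / (k 1 * (t - s)) := by
      field_simp
    rwa [heq] at h

end Harnack

/-! ### The function `Λ` -/

/-- The formula for `Λ` on `(0, t_*]`. -/
noncomputable def earlyLam (c γ δ t : ℝ) : ℝ :=
  t / δ * (1 - Real.log (2 ^ γ * c * δ ^ (1 - γ) * t))

/-- The formula for `Λ` on `(t_*, ∞)`, without the additive constant. -/
noncomputable def lateLam (c γ t : ℝ) : ℝ :=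
  if γ = 2 then Real.log t / (c * Real.exp 2)
  else ((γ - 1) * t) ^ ((γ - 2) / (γ - 1)) / ((c * Real.exp 2) ^ (1 / (γ - 1)) * (γ - 2))

/-- The additive constant that makes `Λ` continuous at `t_*`. -/
noncomputable def lamShift (c γ δ : ℝ) : ℝ :=
  earlyLam c γ δ (tStar c γ δ) - lateLam c γ (tStar c γ δ)

/-- The derivative of `Λ` on `(0, t_*)`: the solution of `ψ' = -2^γ c δ^(-γ) e^(δ ψ)` that is
infinite at time zero. -/
noncomputable def earlyRate (c γ δ t : ℝ) : ℝ := -Real.log (2 ^ γ * c * δ ^ (1 - γ) * t) / δ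

/-- The derivative of `Λ` on `(t_*, ∞)`: the solution of `ψ' = -c e² ψ^γ` that is infinite at time
zero. -/
noncomputable def lateRate (c γ t : ℝ) : ℝ :=
  ((γ - 1) * t * (c * Real.exp 2)) ^ (-(1 / (γ - 1)))

section Lam

variable {c γ δ : ℝ}

theorem Lam_lamShift (c γ δ t : ℝ) : Lam c γ δ (lamShift c γ δ) (lamShift c γ δ) t =
    if t ≤ tStar c γ δ then earlyLam c γ δ t else lateLam c γ t + lamShift c γ δ := by
  unfold Lam earlyLam lateLam
  split_ifs <;> rfl

theorem tStar_pos (hc : 0 < c) (hδ : 0 < δ) : 0 < tStar c γ δ := by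
  unfold tStar
  positivity

theorem mul_tStar (hc : 0 < c) (hδ : 0 < δ) :
    2 ^ γ * c * δ ^ (1 - γ) * tStar c γ δ = Real.exp (-2) := by
  have h : δ ^ (1 - γ) * δ ^ (γ - 1) = 1 := by
    rw [← Real.rpow_add hδ]
    simp
  have h2 : (2 : ℝ) ^ γ ≠ 0 := by positivity
  rw [tStar, Real.exp_neg, mul_div_assoc', mul_assoc _ (δ ^ (1 - γ)), h]
  field_simp

theorem log_le_of_le_tStar (hc : 0 < c) (hδ : 0 < δ) {t : ℝ} (ht : 0 < t)
    (htS : t ≤ tStar c γ δ) : Real.log (2 ^ γ * c * δ ^ (1 - γ) * t) ≤ -2 := by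
  rw [Real.log_le_iff_le_exp (by positivity), ← mul_tStar hc hδ (γ := γ)]
  exact mul_le_mul_of_nonneg_left htS (by positivity)

theorem earlyLam_pos (hc : 0 < c) (hδ : 0 < δ) {t : ℝ} (ht : 0 < t) (htS : t ≤ tStar c γ δ) :
    0 < earlyLam c γ δ t :=
  mul_pos (div_pos ht hδ) (by linarith [log_le_of_le_tStar hc hδ ht htS])

theorem continuous_earlyLam (hc : 0 < c) (hδ : 0 < δ) : Continuous (earlyLam c γ δ) := by
  set b := 2 ^ γ * c * δ ^ (1 - γ) with hb
  have hb0 : b ≠ 0 := by positivity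
  have h : earlyLam c γ δ = fun t => (t - b * t * Real.log (b * t) / b) / δ := by
    funext t
    rw [earlyLam, ← hb]
    field_simp
  rw [h]
  have := Real.continuous_mul_log.comp (continuous_const_mul b)
  exact (continuous_id.sub (this.div_const b)).div_const δ

theorem hasDerivAt_log_const_mul {b t : ℝ} (hb : 0 < b) (ht : 0 < t) :
    HasDerivAt (fun t => Real.log (b * t)) t⁻¹ t := by
  refine (((hasDerivAt_id t).const_mul b).log (mul_pos hb ht).ne').congr_deriv ?_
  simp only [id]
  field_simp

theorem hasDerivAt_earlyLam (hc : 0 < c) (hδ : 0 < δ) {t : ℝ} (ht : 0 < t) :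
    HasDerivAt (earlyLam c γ δ) (earlyRate c γ δ t) t := by
  have hb : 0 < 2 ^ γ * c * δ ^ (1 - γ) := by positivity
  have h := ((hasDerivAt_id t).div_const δ).mul ((hasDerivAt_log_const_mul hb ht).const_sub 1)
  refine h.congr_deriv ?_
  simp only [id, earlyRate]
  field_simp
  ring

theorem hasDerivAt_earlyRate (hc : 0 < c) (hδ : 0 < δ) {t : ℝ} (ht : 0 < t) :
    HasDerivAt (earlyRate c γ δ) (-t⁻¹ / δ) t :=
  (hasDerivAt_log_const_mul (by positivity) ht).neg.div_const δ

theorem hasDerivAt_lateLam (hc : 0 < c) (hγ : 2 ≤ γ) {t : ℝ} (ht : 0 < t) :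
    HasDerivAt (lateLam c γ) (lateRate c γ t) t := by
  have hE := Real.exp_pos 2
  rcases eq_or_lt_of_le hγ with rfl | hγ2
  · have h : lateLam c 2 = fun t => Real.log t / (c * Real.exp 2) := by
      funext t
      simp [lateLam]
    rw [h]
    refine ((Real.hasDerivAt_log ht.ne').div_const (c * Real.exp 2)).congr_deriv ?_
    rw [lateRate]
    norm_num [Real.rpow_neg_one]
    field_simp
  · have hγ1 : 0 < γ - 1 := by linarith
    have hγ2' : 0 < γ - 2 := by linarith
    have h : lateLam c γ = fun t => ((γ - 1) * t) ^ ((γ - 2) / (γ - 1)) /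
        ((c * Real.exp 2) ^ (1 / (γ - 1)) * (γ - 2)) := by
      funext t
      simp [lateLam, hγ2.ne']
    rw [h]
    have hd := (((hasDerivAt_id t).const_mul (γ - 1)).rpow_const (p := (γ - 2) / (γ - 1))
      (Or.inl (mul_pos hγ1 ht).ne')).div_const ((c * Real.exp 2) ^ (1 / (γ - 1)) * (γ - 2))
    refine hd.congr_deriv ?_
    have hexp : (γ - 2) / (γ - 1) - 1 = -(1 / (γ - 1)) := by field_simp; ring
    have hpos : 0 < (c * Real.exp 2) ^ (1 / (γ - 1)) := by positivity
    rw [lateRate, Real.mul_rpow (mul_pos hγ1 ht).le (by positivity : 0 ≤ c * Real.exp 2), hexp,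
      Real.rpow_neg (by positivity : 0 ≤ c * Real.exp 2)]
    simp only [id]
    field_simp

theorem lateRate_pos (hc : 0 < c) (hγ : 2 ≤ γ) {t : ℝ} (ht : 0 < t) : 0 < lateRate c γ t := by
  have hγ1 : 0 < γ - 1 := by linarith
  unfold lateRate
  positivity

theorem hasDerivAt_lateRate (hc : 0 < c) (hγ : 2 ≤ γ) {t : ℝ} (ht : 0 < t) :
    HasDerivAt (lateRate c γ) (-(c * Real.exp 2 * lateRate c γ t ^ γ)) t := by
  have hγ1 : 0 < γ - 1 := by linarith
  have hpos : 0 < (γ - 1) * t * (c * Real.exp 2) := by positivity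
  have hd := (((hasDerivAt_id t).const_mul (γ - 1)).mul_const (c * Real.exp 2)).rpow_const
    (p := -(1 / (γ - 1))) (Or.inl hpos.ne')
  refine hd.congr_deriv ?_
  simp only [id]
  rw [lateRate, ← Real.rpow_mul hpos.le]
  have hexp : -(1 / (γ - 1)) * γ = -(1 / (γ - 1)) - 1 := by field_simp; ring
  rw [hexp]
  field_simp

theorem lateLam_mono (hc : 0 < c) (hγ : 2 ≤ γ) {s t : ℝ} (hs : 0 < s) (hst : s ≤ t) :
    lateLam c γ s ≤ lateLam c γ t := by
  refine monotoneOn_of_deriv_nonneg (convex_Ioi 0)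
    (fun t ht => (hasDerivAt_lateLam hc hγ ht).continuousAt.continuousWithinAt) ?_ ?_
    (Set.mem_Ioi.2 hs) (Set.mem_Ioi.2 (hs.trans_le hst)) hst
  · rw [interior_Ioi]
    exact fun t ht => (hasDerivAt_lateLam hc hγ ht).differentiableAt.differentiableWithinAt
  · rw [interior_Ioi]
    intro t ht
    rw [(hasDerivAt_lateLam hc hγ ht).deriv]
    exact (lateRate_pos hc hγ ht).le

theorem Lam_pos (hc : 0 < c) (hγ : 2 ≤ γ) (hδ : 0 < δ) {t : ℝ} (ht : 0 < t) :
    0 < Lam c γ δ (lamShift c γ δ) (lamShift c γ δ) t := by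
  rw [Lam_lamShift]
  split_ifs with h
  · exact earlyLam_pos hc hδ ht h
  · have h1 := earlyLam_pos hc hδ (tStar_pos hc hδ (γ := γ)) le_rfl
    have h2 := lateLam_mono hc hγ (tStar_pos hc hδ) (not_le.1 h).le
    rw [lamShift]
    linarith

theorem continuous_Lam (hc : 0 < c) (hγ : 2 ≤ γ) (hδ : 0 < δ) :
    Continuous (Lam c γ δ (lamShift c γ δ) (lamShift c γ δ)) := by
  have h : Lam c γ δ (lamShift c γ δ) (lamShift c γ δ) = fun t =>
      earlyLam c γ δ (min t (tStar c γ δ)) + lateLam c γ (max t (tStar c γ δ)) -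
        lateLam c γ (tStar c γ δ) := by
    funext t
    rw [Lam_lamShift]
    split_ifs with h
    · rw [min_eq_left h, max_eq_right h]
      ring
    · rw [min_eq_right (not_le.1 h).le, max_eq_left (not_le.1 h).le, lamShift]
      ring
  rw [h]
  have hlate : Continuous fun t => lateLam c γ (max t (tStar c γ δ)) :=
    continuous_iff_continuousAt.2 fun t =>
      (hasDerivAt_lateLam hc hγ (lt_max_of_lt_right (tStar_pos hc hδ))).continuousAt.comp
        (f := fun t => max t (tStar c γ δ)) (continuous_id.max continuous_const).continuousAt
  exact (((continuous_earlyLam hc hδ).comp (continuous_id.min continuous_const)).add hlate).sub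
    continuous_const

theorem Lam_zero (hc : 0 < c) (hδ : 0 < δ) :
    Lam c γ δ (lamShift c γ δ) (lamShift c γ δ) 0 = 0 := by
  rw [Lam_lamShift, if_pos (tStar_pos hc hδ).le, earlyLam]
  simp

theorem hasDerivWithinAt_Lam (hc : 0 < c) (hγ : 2 ≤ γ) (hδ : 0 < δ) {t : ℝ} (ht : 0 < t) :
    HasDerivWithinAt (Lam c γ δ (lamShift c γ δ) (lamShift c γ δ))
      (if t < tStar c γ δ then earlyRate c γ δ t else lateRate c γ t) (Set.Ici t) t := by
  split_ifs with h
  · refine ((hasDerivAt_earlyLam hc hδ ht).congr_of_eventuallyEq ?_).hasDerivWithinAt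
    filter_upwards [gt_mem_nhds h] with s hs
    rw [Lam_lamShift, if_pos hs.le]
  · have hlate : ∀ s ∈ Set.Ici t, Lam c γ δ (lamShift c γ δ) (lamShift c γ δ) s =
        lateLam c γ s + lamShift c γ δ := by
      intro s hs
      rw [Lam_lamShift]
      split_ifs with h1
      · rw [le_antisymm h1 ((not_lt.1 h).trans hs), lamShift]
        ring
      · rfl
    exact ((hasDerivAt_lateLam hc hγ ht).add_const _).hasDerivWithinAt.congr hlate
      (hlate t (Set.mem_Ici.2 le_rfl))

theorem tendsto_earlyRate (hc : 0 < c) (hδ : 0 < δ) :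
    Tendsto (earlyRate c γ δ) (𝓝[>] 0) atTop := by
  have hb : 0 < 2 ^ γ * c * δ ^ (1 - γ) := by positivity
  have h1 : Tendsto (fun t : ℝ => 2 ^ γ * c * δ ^ (1 - γ) * t) (𝓝[>] 0) (𝓝[>] 0) := by
    refine tendsto_nhdsWithin_iff.2 ⟨?_, ?_⟩
    · have := (continuous_const_mul (2 ^ γ * c * δ ^ (1 - γ))).tendsto 0
      rw [mul_zero] at this
      exact this.mono_left nhdsWithin_le_nhds
    · filter_upwards [self_mem_nhdsWithin] with t ht
      exact mul_pos hb ht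
  exact (tendsto_neg_atBot_atTop.comp (Real.tendsto_log_nhdsGT_zero.comp h1)).atTop_div_const hδ

theorem tendsto_lateRate (hc : 0 < c) (hγ : 2 ≤ γ) :
    Tendsto (lateRate c γ) (𝓝[>] 0) atTop := by
  have hγ1 : 0 < γ - 1 := by linarith
  have h1 : Tendsto (fun t : ℝ => (γ - 1) * t * (c * Real.exp 2)) (𝓝[>] 0) (𝓝[>] 0) := by
    refine tendsto_nhdsWithin_iff.2 ⟨?_, ?_⟩
    · have : Continuous fun t : ℝ => (γ - 1) * t * (c * Real.exp 2) := by fun_prop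
      have := this.tendsto 0
      rw [mul_zero, zero_mul] at this
      exact this.mono_left nhdsWithin_le_nhds
    · filter_upwards [self_mem_nhdsWithin] with t ht
      have ht : 0 < t := ht
      exact Set.mem_Ioi.2 (by positivity)
  exact (tendsto_rpow_neg_nhdsGT_zero (neg_neg_of_pos (one_div_pos.2 hγ1))).comp h1

end Lam

/-! ### The lower bound -/

/-- `F` dominates `c e² x^γ / 2` everywhere and `2^(γ-1) c δ^(-γ) e^(δ x)` beyond `2 / δ`. The two
minorants agree at `2 / δ`. -/
structure Dominates (F : ℝ → ℝ) (c γ δ : ℝ) : Prop where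
  rpow_le : ∀ x, 0 ≤ x → c * Real.exp 2 / 2 * x ^ γ ≤ F x
  exp_le : ∀ x, 2 / δ ≤ x → 2 ^ γ * c * δ ^ (-γ) / 2 * Real.exp (δ * x) ≤ F x

theorem rpow_le_mul_exp {γ δ x : ℝ} (hγ : 0 < γ) (hδ : 0 < δ) (hx : 0 ≤ x) :
    x ^ γ ≤ (γ / δ) ^ γ * Real.exp (δ * x) := by
  have h1 : x = γ / δ * (δ * x / γ) := by field_simp
  have h2 : 0 ≤ δ * x / γ := by positivity
  calc x ^ γ = (γ / δ) ^ γ * (δ * x / γ) ^ γ := by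
        rw [← Real.mul_rpow (by positivity) h2, ← h1]
    _ ≤ (γ / δ) ^ γ * Real.exp (δ * x / γ) ^ γ := by
        gcongr
        linarith [Real.add_one_le_exp (δ * x / γ)]
    _ = (γ / δ) ^ γ * Real.exp (δ * x) := by
        rw [← Real.exp_mul]
        congr 2
        field_simp

theorem eventually_half_le_of_isEquivalent {l : Filter ℝ} {f g : ℝ → ℝ} (h : f ~[l] g)
    (hg : ∀ᶠ x in l, 0 ≤ g x) : ∀ᶠ x in l, g x / 2 ≤ f x := by
  filter_upwards [h.isLittleO.def (c := 1 / 2) (by norm_num), hg] with x hx hx0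
  rw [Pi.sub_apply, Real.norm_eq_abs, Real.norm_eq_abs, abs_of_nonneg hx0] at hx
  linarith [neg_le_abs (f x - g x)]

theorem IsCDFunction.exists_dominates {F : ℝ → ℝ} (hF : IsCDFunction F) {γ δ c₁ c₂ : ℝ}
    (hγ : 0 < γ) (hδ : 0 < δ) (hc₁ : 0 < c₁) (hc₂ : 0 < c₂)
    (h0 : F ~[𝓝[>] 0] fun x => c₁ * x ^ γ) (hinf : F ~[atTop] fun x => c₂ * Real.exp (δ * x)) :
    ∃ c : ℝ, 0 < c ∧ Dominates F c γ δ := by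
  obtain ⟨a, ha, hFa⟩ : ∃ a, 0 < a ∧ ∀ x ∈ Set.Ioo 0 a, c₁ * x ^ γ / 2 ≤ F x := by
    have h := eventually_half_le_of_isEquivalent h0 (by
      filter_upwards [self_mem_nhdsWithin] with x hx
      exact mul_nonneg hc₁.le (Real.rpow_nonneg (le_of_lt hx) _))
    obtain ⟨a, ha, h⟩ := mem_nhdsGT_iff_exists_Ioo_subset.1 h
    exact ⟨a, ha, fun x hx => h hx⟩
  obtain ⟨b, hFb⟩ : ∃ b, ∀ x, b ≤ x → c₂ * Real.exp (δ * x) / 2 ≤ F x :=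
    eventually_atTop.1 (eventually_half_le_of_isEquivalent hinf
      (Eventually.of_forall fun x => by positivity))
  -- `F` is bounded below by a multiple of `e^(δ x)` on `[r, ∞)`; on `[r, b]` because it is monotone.
  set r := min a (2 / δ) with hr
  have hr0 : 0 < r := lt_min ha (by positivity)
  set m := min (c₂ / 2) (F r * Real.exp (-(δ * b))) with hm
  have hm0 : 0 < m := lt_min (by positivity) (mul_pos (hF.pos hr0) (Real.exp_pos _))
  have hFr : ∀ x, r ≤ x → m * Real.exp (δ * x) ≤ F x := by
    intro x hx
    rcases le_total b x with h | h
    · refine le_trans ?_ (hFb x h)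
      have := mul_le_mul_of_nonneg_right (min_le_left (c₂ / 2) (F r * Real.exp (-(δ * b))))
        (Real.exp_pos (δ * x)).le
      rw [← hm] at this
      linarith
    · calc m * Real.exp (δ * x) ≤ F r * Real.exp (-(δ * b)) * Real.exp (δ * x) :=
            mul_le_mul_of_nonneg_right (min_le_right _ _) (Real.exp_pos _).le
        _ = F r * Real.exp (δ * x - δ * b) := by rw [mul_assoc, ← Real.exp_add]; ring_nf
        _ ≤ F r * 1 := by
            refine mul_le_mul_of_nonneg_left (Real.exp_le_one_iff.2 ?_) (hF.pos hr0).le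
            nlinarith
        _ = F r := mul_one _
        _ ≤ F x := hF.monotoneOn (Set.mem_Ici.2 hr0.le) (Set.mem_Ici.2 (hr0.le.trans hx)) hx
  have hE := Real.exp_pos 2
  set G := (γ / δ) ^ γ with hG
  have hG0 : 0 < G := by positivity
  set H := (2 : ℝ) ^ γ * δ ^ (-γ) with hH
  have hH0 : 0 < H := by positivity
  refine ⟨min (c₁ / Real.exp 2) (min (2 * m / (Real.exp 2 * G)) (2 * m / H)), by positivity, ?_, ?_⟩
  · intro x hx
    rcases eq_or_lt_of_le hx with rfl | hx0
    · rw [Real.zero_rpow hγ.ne', mul_zero, hF.zero]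
    have hxγ := Real.rpow_nonneg hx γ
    rcases lt_or_ge x r with h | h
    · have h1 : min (c₁ / Real.exp 2) (min (2 * m / (Real.exp 2 * G)) (2 * m / H)) ≤
        c₁ / Real.exp 2 := min_le_left _ _
      rw [le_div_iff₀ hE] at h1
      have h2 := hFa x ⟨hx0, h.trans_le (min_le_left _ _)⟩
      nlinarith
    · have h1 : min (c₁ / Real.exp 2) (min (2 * m / (Real.exp 2 * G)) (2 * m / H)) ≤
        2 * m / (Real.exp 2 * G) := (min_le_right _ _).trans (min_le_left _ _)
      have h2 := hFr x h
      have h3 := rpow_le_mul_exp hγ hδ hx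
      rw [← hG] at h3
      calc min (c₁ / Real.exp 2) (min (2 * m / (Real.exp 2 * G)) (2 * m / H)) * Real.exp 2 / 2 *
            x ^ γ ≤ 2 * m / (Real.exp 2 * G) * Real.exp 2 / 2 * (G * Real.exp (δ * x)) := by
            gcongr
        _ = m * Real.exp (δ * x) := by field_simp
        _ ≤ F x := h2
  · intro x hx
    have h1 : min (c₁ / Real.exp 2) (min (2 * m / (Real.exp 2 * G)) (2 * m / H)) ≤ 2 * m / H :=
      (min_le_right _ _).trans (min_le_right _ _)
    rw [le_div_iff₀ hH0] at h1
    refine le_trans ?_ (hFr x ((min_le_right _ _).trans hx))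
    refine mul_le_mul_of_nonneg_right ?_ (Real.exp_pos _).le
    rw [hH] at h1
    linarith

section

variable {c γ δ V : ℝ} {F : ℝ → ℝ} {v : ℝ → ℤ → ℝ}

theorem Dominates.earlyRate_le (hF : Dominates F c γ δ) (hc : 0 < c) (hδ : 0 < δ) {t : ℝ}
    (ht : 0 < t) (htS : t ≤ tStar c γ δ) :
    0 ≤ earlyRate c γ δ t ∧ -2 * F (earlyRate c γ δ t) ≤ -t⁻¹ / δ := by
  have hlog := log_le_of_le_tStar hc hδ ht htS
  have hr : 2 / δ ≤ earlyRate c γ δ t := div_le_div_of_nonneg_right (by linarith) hδ.le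
  refine ⟨(div_nonneg two_pos.le hδ.le).trans hr, ?_⟩
  have h := hF.exp_le _ hr
  have hexp : Real.exp (δ * earlyRate c γ δ t) = (2 ^ γ * c * δ ^ (1 - γ) * t)⁻¹ := by
    rw [earlyRate, mul_div_cancel₀ _ hδ.ne', Real.exp_neg, Real.exp_log (by positivity)]
  have hpow : δ ^ (1 - γ) = δ * δ ^ (-γ) := by
    rw [sub_eq_add_neg, Real.rpow_add hδ, Real.rpow_one]
  have h2 : (0 : ℝ) < 2 ^ γ := by positivity
  have h3 : 0 < δ ^ (-γ) := by positivity
  rw [hexp, hpow] at h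
  have h4 : 2 ^ γ * c * δ ^ (-γ) / 2 * (2 ^ γ * c * (δ * δ ^ (-γ)) * t)⁻¹ = t⁻¹ / δ / 2 := by
    field_simp
  rw [h4] at h
  rw [neg_div]
  linarith

theorem Dominates.isLiYauPrimitive (hdom : Dominates F c γ δ) (hc : 0 < c) (hγ : 2 ≤ γ)
    (hδ : 0 < δ) (hk : IsKernel k) (hF : IsCDFunction F) (hCD : CDUpsilon k F)
    (hv : IsLogHeat k V v) :
    IsLiYauPrimitive k v (Lam c γ δ (lamShift c γ δ) (lamShift c γ δ))
      fun t => if t < tStar c γ δ then earlyRate c γ δ t else lateRate c γ t where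
  cont := (continuous_Lam hc hγ hδ).continuousOn
  deriv _ ht := hasDerivWithinAt_Lam hc hγ hδ ht
  le t ht x := by
    split_ifs with h
    · exact hv.neg_gen_le hk hF hCD (fun s hs => hasDerivAt_earlyRate hc hδ hs.1)
        (fun s hs => (hdom.earlyRate_le hc hδ hs.1 (hs.2.trans h.le)).1)
        (fun s hs => (hdom.earlyRate_le hc hδ hs.1 (hs.2.trans h.le)).2)
        (tendsto_earlyRate hc hδ) ht x
    · exact hv.neg_gen_le hk hF hCD (fun s hs => hasDerivAt_lateRate hc hγ hs.1)
        (fun s hs => (lateRate_pos hc hγ hs.1).le)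
        (fun s hs => by linarith [hdom.rpow_le _ (lateRate_pos hc hγ hs.1).le])
        (tendsto_lateRate hc hγ) ht x

theorem Dominates.exp_neg_Lam_le (hdom : Dominates F c γ δ) (hc : 0 < c) (hγ : 2 ≤ γ)
    (hδ : 0 < δ) (hk : IsKernel k) (hF : IsCDFunction F) (hCD : CDUpsilon k F)
    {p : ℝ → ℤ → ℤ → ℝ} (hp : IsHeatKernel k p) (h1 : 0 < k 1) {t : ℝ} (ht : 0 < t) (x y : ℤ) :
    Real.exp (-(Lam c γ δ (lamShift c γ δ) (lamShift c γ δ) t +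
      2 * |(x : ℝ) - (y : ℝ)| ^ 2 / (k 1 * t))) ≤ p t x y := by
  -- Adding `ε` to the heat kernel keeps its logarithm bounded, as the condition on `L` requires.
  have hε : ∀ ε : ℝ, 0 < ε → ε ≤ 1 →
      Real.exp (-(Lam c γ δ (lamShift c γ δ) (lamShift c γ δ) t +
        2 * |(x : ℝ) - (y : ℝ)| ^ 2 / (k 1 * t))) ≤ p t x y + ε := by
    intro ε hε hε1
    have hv := hp.isLogHeat hk hε hε1 y
    have hΛ := hdom.isLiYauPrimitive hc hγ hδ hk hF hCD hv
    have hlim : Tendsto (fun s => Real.log (p s y y + ε) +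
        Lam c γ δ (lamShift c γ δ) (lamShift c γ δ) s -
          2 * |(x : ℝ) - (y : ℝ)| ^ 2 / (k 1 * (t - s))) (𝓝[>] 0)
        (𝓝 (Real.log (1 + ε) + 0 - 2 * |(x : ℝ) - (y : ℝ)| ^ 2 / (k 1 * (t - 0)))) := by
      refine (Tendsto.add ?_ ?_).sub ?_
      · have h := (hp.continuous_zero y y).tendsto.mono_left
          (nhdsWithin_mono _ Set.Ioi_subset_Ici_self)
        rw [hp.initial, if_pos rfl] at h
        exact (h.add_const ε).log (by positivity)
      · have h := (continuous_Lam hc hγ hδ).tendsto 0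
        rw [Lam_zero hc hδ] at h
        exact h.mono_left nhdsWithin_le_nhds
      · have h : ContinuousAt
            (fun s => 2 * |(x : ℝ) - (y : ℝ)| ^ 2 / (k 1 * (t - s))) 0 := by
          refine ContinuousAt.div (by fun_prop) (by fun_prop) ?_
          rw [sub_zero]
          positivity
        exact h.tendsto.mono_left nhdsWithin_le_nhds
    have hle := le_of_tendsto hlim (by
      filter_upwards [Ioo_mem_nhdsGT ht] with s hs
      exact hv.harnack hk hΛ h1 hs.1 hs.2 x y)
    rw [sub_zero] at hle
    have hpos : 0 < p t x y + ε := by linarith [hp.nonneg hk ht.le x y]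
    rw [← Real.le_log_iff_exp_le hpos]
    have hlog : 0 ≤ Real.log (1 + ε) := Real.log_nonneg (by linarith)
    linarith
  refine le_of_forall_pos_le_add fun ε hε0 => ?_
  exact (hε (min ε 1) (lt_min hε0 one_pos) (min_le_right _ _)).trans
    (by linarith [min_le_left ε 1])

end

/-! ### Fourier representation of the heat kernel -/

/-- The Fourier symbol `θ ↦ ∑_j k(j) (1 - cos (j θ))` of `-L`. -/
noncomputable def symbol (k : ℤ → ℝ) (θ : ℝ) : ℝ :=
  ∑' j : ℤ, k j * (1 - Real.cos (j * θ))

/-- The heat kernel as a Fourier integral. -/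
noncomputable def fourierKernel (k : ℤ → ℝ) (t : ℝ) (x y : ℤ) : ℝ :=
  (2 * Real.pi)⁻¹ *
    ∫ θ in -Real.pi..Real.pi, Real.exp (-t * symbol k θ) * Real.cos ((x - y) * θ)

theorem abs_one_sub_cos_le (a : ℝ) : |1 - Real.cos a| ≤ 2 :=
  abs_le.2 ⟨by linarith [Real.cos_le_one a], by linarith [Real.neg_one_le_cos a]⟩

theorem IsKernel.norm_symbol_term_le (hk : IsKernel k) (j : ℤ) (θ : ℝ) :
    ‖k j * (1 - Real.cos (j * θ))‖ ≤ k j * 2 := by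
  rw [norm_mul, Real.norm_of_nonneg (hk.nonneg j)]
  exact mul_le_mul_of_nonneg_left (abs_one_sub_cos_le _) (hk.nonneg j)

theorem IsKernel.summable_symbol (hk : IsKernel k) (θ : ℝ) :
    Summable fun j : ℤ => k j * (1 - Real.cos (j * θ)) :=
  Summable.of_norm_bounded (hk.summable.mul_right 2) fun j => hk.norm_symbol_term_le j θ

theorem IsKernel.continuous_symbol (hk : IsKernel k) : Continuous (symbol k) :=
  continuous_tsum (fun j => by fun_prop) (hk.summable.mul_right 2)
    fun j θ => hk.norm_symbol_term_le j θ

theorem IsKernel.symbol_term_nonneg (hk : IsKernel k) (j : ℤ) (θ : ℝ) :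
    0 ≤ k j * (1 - Real.cos (j * θ)) :=
  mul_nonneg (hk.nonneg j) (by linarith [Real.cos_le_one (j * θ)])

theorem IsKernel.symbol_nonneg (hk : IsKernel k) (θ : ℝ) : 0 ≤ symbol k θ :=
  tsum_nonneg fun j => hk.symbol_term_nonneg j θ

theorem IsKernel.symbol_le (hk : IsKernel k) (θ : ℝ) : symbol k θ ≤ mass k * 2 := by
  rw [mass, ← tsum_mul_right]
  exact (hk.summable_symbol θ).tsum_le_tsum
    (fun j => (le_abs_self _).trans (hk.norm_symbol_term_le j θ)) (hk.summable.mul_right 2)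

theorem IsKernel.two_mul_le_symbol (hk : IsKernel k) {j : ℤ} (hj : j ≠ 0) (θ : ℝ) :
    2 * (k j * (1 - Real.cos (j * θ))) ≤ symbol k θ := by
  have h := (hk.summable_symbol θ).sum_le_tsum {j, -j} fun i _ => hk.symbol_term_nonneg i θ
  rw [Finset.sum_pair (by omega), hk.symm j] at h
  push_cast at h
  rw [neg_mul, Real.cos_neg, ← two_mul] at h
  exact h

theorem IsKernel.tsum_mul_sin (hk : IsKernel k) (θ : ℝ) :
    ∑' j : ℤ, k j * Real.sin (j * θ) = 0 := by
  have h := (Equiv.neg ℤ).tsum_eq fun j : ℤ => k j * Real.sin (j * θ)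
  have h2 : ∀ j : ℤ, k (Equiv.neg ℤ j) * Real.sin ((Equiv.neg ℤ j : ℤ) * θ) =
      -(k j * Real.sin (j * θ)) := fun j => by
    rw [Equiv.neg_apply, hk.symm]
    push_cast
    rw [neg_mul, Real.sin_neg]
    ring
  rw [tsum_congr h2, tsum_neg] at h
  linarith

/-- The functions `z ↦ cos ((z - y) θ)` are eigenfunctions of `L`. -/
theorem IsKernel.gen_cos (hk : IsKernel k) (θ : ℝ) (x y : ℤ) :
    gen k (fun z => Real.cos (((z : ℝ) - y) * θ)) x =
      -symbol k θ * Real.cos (((x : ℝ) - y) * θ) := by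
  have hsin : Summable fun j : ℤ => k j * Real.sin (j * θ) := by
    refine Summable.of_norm_bounded hk.summable fun j => ?_
    rw [norm_mul, Real.norm_of_nonneg (hk.nonneg j)]
    exact mul_le_of_le_one_right (hk.nonneg j) (Real.abs_sin_le_one _)
  have h := (Equiv.subLeft x).tsum_eq fun j : ℤ =>
    k j * (Real.cos (((x : ℝ) - j - y) * θ) - Real.cos (((x : ℝ) - y) * θ))
  have h1 : gen k (fun z => Real.cos (((z : ℝ) - y) * θ)) x = ∑' j : ℤ,
      k j * (Real.cos (((x : ℝ) - j - y) * θ) - Real.cos (((x : ℝ) - y) * θ)) := by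
    rw [← h, gen]
    refine tsum_congr fun z => ?_
    simp only [Equiv.subLeft_apply]
    push_cast
    rw [sub_sub_cancel]
  have h2 : ∀ j : ℤ, k j * (Real.cos (((x : ℝ) - j - y) * θ) - Real.cos (((x : ℝ) - y) * θ)) =
      k j * Real.sin (j * θ) * Real.sin (((x : ℝ) - y) * θ) -
        k j * (1 - Real.cos (j * θ)) * Real.cos (((x : ℝ) - y) * θ) := fun j => by
    rw [show ((x : ℝ) - j - y) * θ = ((x : ℝ) - y) * θ - j * θ by ring, Real.cos_sub]
    ring
  rw [h1, tsum_congr h2, (hsin.mul_right _).tsum_sub ((hk.summable_symbol θ).mul_right _),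
    tsum_mul_right, tsum_mul_right, hk.tsum_mul_sin, ← symbol]
  ring

theorem IsKernel.continuous_fourier_integrand (hk : IsKernel k) (t a : ℝ) :
    Continuous fun θ => Real.exp (-t * symbol k θ) * Real.cos (a * θ) := by
  have := hk.continuous_symbol
  fun_prop

theorem IsKernel.hasDerivAt_fourierKernel (hk : IsKernel k) (t : ℝ) (x y : ℤ) :
    HasDerivAt (fun t => fourierKernel k t x y) ((2 * Real.pi)⁻¹ *
      ∫ θ in -Real.pi..Real.pi, -symbol k θ * (Real.exp (-t * symbol k θ) *
        Real.cos ((x - y) * θ))) t := by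
  have hcs := hk.continuous_symbol
  refine HasDerivAt.const_mul _ ?_
  refine (intervalIntegral.hasDerivAt_integral_of_dominated_loc_of_deriv_le
    (F := fun t θ => Real.exp (-t * symbol k θ) * Real.cos ((x - y) * θ))
    (F' := fun t θ => -symbol k θ * (Real.exp (-t * symbol k θ) * Real.cos ((x - y) * θ)))
    (bound := fun _ => mass k * 2 * Real.exp ((|t| + 1) * (mass k * 2)))
    (Metric.ball_mem_nhds t one_pos) ?_ ?_ ?_ ?_ ?_ ?_).2
  · exact Eventually.of_forall fun s =>
      (hk.continuous_fourier_integrand s _).aestronglyMeasurable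
  · exact (hk.continuous_fourier_integrand t _).intervalIntegrable _ _
  · exact (hcs.neg.mul (hk.continuous_fourier_integrand t _)).aestronglyMeasurable
  · refine Eventually.of_forall fun θ _ s hs => ?_
    have h0 := hk.symbol_nonneg θ
    have h2 := hk.symbol_le θ
    have hs1 : -s ≤ |t| + 1 := by
      have := abs_lt.1 (Metric.mem_ball.1 hs)
      linarith [neg_abs_le t]
    rw [norm_mul, norm_mul, norm_neg, Real.norm_of_nonneg h0,
      Real.norm_of_nonneg (Real.exp_pos _).le]
    have h3 : Real.exp (-s * symbol k θ) ≤ Real.exp ((|t| + 1) * (mass k * 2)) :=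
      Real.exp_le_exp.2 ((mul_le_mul_of_nonneg_right hs1 h0).trans
        (mul_le_mul_of_nonneg_left h2 (by positivity)))
    have h4 : ‖Real.cos ((x - y) * θ)‖ ≤ 1 := Real.abs_cos_le_one _
    calc symbol k θ * (Real.exp (-s * symbol k θ) * ‖Real.cos ((x - y) * θ)‖)
        ≤ mass k * 2 * (Real.exp ((|t| + 1) * (mass k * 2)) * 1) := by
          gcongr
          linarith
      _ = _ := by rw [mul_one]
  · exact intervalIntegrable_const
  · refine Eventually.of_forall fun θ _ s _ => ?_
    have h := (((hasDerivAt_id s).neg.mul_const (symbol k θ)).exp).mul_const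
      (Real.cos ((x - y) * θ))
    refine h.congr_deriv ?_
    simp only [Pi.neg_apply, id]
    ring

theorem IsKernel.tsum_fourierKernel (hk : IsKernel k) (t : ℝ) (x y : ℤ) :
    ∑' z, k (x - z) * (fourierKernel k t z y - fourierKernel k t x y) = (2 * Real.pi)⁻¹ *
      ∫ θ in -Real.pi..Real.pi, -symbol k θ * (Real.exp (-t * symbol k θ) *
        Real.cos ((x - y) * θ)) := by
  have hcs := hk.continuous_symbol
  have hcos : ∀ (θ : ℝ) (z : ℤ),
      |Real.cos (((z : ℝ) - y) * θ) - Real.cos (((x : ℝ) - y) * θ)| ≤ 2 * 1 := fun θ z =>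
    abs_sub_le_two_mul (f := fun z : ℤ => Real.cos (((z : ℝ) - y) * θ))
      (fun z => Real.abs_cos_le_one _) x z
  have hsum := intervalIntegral.hasSum_integral_of_dominated_convergence
    (a := -Real.pi) (b := Real.pi) (μ := MeasureTheory.volume)
    (F := fun z θ => Real.exp (-t * symbol k θ) *
      (k (x - z) * (Real.cos (((z : ℝ) - y) * θ) - Real.cos (((x : ℝ) - y) * θ))))
    (f := fun θ => -symbol k θ * (Real.exp (-t * symbol k θ) * Real.cos ((x - y) * θ)))
    (fun z θ => Real.exp (-t * symbol k θ) * (k (x - z) * (2 * 1)))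
    (fun z => Continuous.aestronglyMeasurable (by fun_prop))
    (fun z => Eventually.of_forall fun θ _ => by
      rw [norm_mul, norm_mul, Real.norm_of_nonneg (Real.exp_pos _).le,
        Real.norm_of_nonneg (hk.nonneg _)]
      exact mul_le_mul_of_nonneg_left (mul_le_mul_of_nonneg_left (hcos θ z) (hk.nonneg _))
        (Real.exp_pos _).le)
    (Eventually.of_forall fun θ _ => ((hk.summable_sub x).mul_right _).mul_left _)
    (by
      simp only [tsum_mul_left, tsum_mul_right]
      exact Continuous.intervalIntegrable (by fun_prop) _ _)
    (Eventually.of_forall fun θ _ => by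
      have h := (hk.summable_mul (hcos θ) x).hasSum.mul_left (Real.exp (-t * symbol k θ))
      have h2 := hk.gen_cos θ x y
      rw [gen] at h2
      rw [h2, mul_left_comm] at h
      exact h)
  rw [← hsum.tsum_eq, ← tsum_mul_left]
  refine tsum_congr fun z => ?_
  rw [fourierKernel, fourierKernel, ← mul_sub, ← intervalIntegral.integral_sub
    ((hk.continuous_fourier_integrand t _).intervalIntegrable _ _)
    ((hk.continuous_fourier_integrand t _).intervalIntegrable _ _), mul_left_comm,
    ← intervalIntegral.integral_const_mul]
  congr 1
  exact intervalIntegral.integral_congr fun θ _ => by ring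

theorem IsKernel.abs_fourierKernel_le_one (hk : IsKernel k) {t : ℝ} (ht : 0 ≤ t) (x y : ℤ) :
    |fourierKernel k t x y| ≤ 1 := by
  have hπ := Real.pi_pos
  have h := intervalIntegral.norm_integral_le_of_norm_le_const (a := -Real.pi) (b := Real.pi)
    (C := 1) (f := fun θ => Real.exp (-t * symbol k θ) * Real.cos ((x - y) * θ)) fun θ _ => by
      rw [norm_mul, Real.norm_of_nonneg (Real.exp_pos _).le]
      refine mul_le_one₀ (Real.exp_le_one_iff.2 ?_) (norm_nonneg _) (Real.abs_cos_le_one _)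
      rw [neg_mul]
      exact neg_nonpos.2 (mul_nonneg ht (hk.symbol_nonneg θ))
  rw [show Real.pi - -Real.pi = 2 * Real.pi by ring, abs_of_pos (by positivity : 0 < 2 * Real.pi),
    one_mul, Real.norm_eq_abs] at h
  rw [fourierKernel, abs_mul, abs_of_pos (by positivity : 0 < (2 * Real.pi)⁻¹)]
  exact (mul_le_mul_of_nonneg_left h (by positivity)).trans_eq (inv_mul_cancel₀ (by positivity))

theorem fourierKernel_zero (k : ℤ → ℝ) (x y : ℤ) :
    fourierKernel k 0 x y = if x = y then 1 else 0 := by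
  have hπ := Real.pi_pos
  simp only [fourierKernel, neg_zero, zero_mul, Real.exp_zero, one_mul]
  split_ifs with h
  · subst h
    simp only [sub_self, zero_mul, Real.cos_zero, intervalIntegral.integral_const, smul_eq_mul,
      mul_one]
    field_simp
    ring
  · have hne : (x : ℝ) - y ≠ 0 := sub_ne_zero.2 (Int.cast_injective.ne h)
    have hsin : Real.sin (((x : ℝ) - y) * Real.pi) = 0 := by
      have := Real.sin_int_mul_pi (x - y)
      push_cast at this
      exact this
    rw [intervalIntegral.integral_comp_mul_left (fun θ => Real.cos θ) hne, integral_cos, mul_neg,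
      Real.sin_neg, hsin]
    simp

theorem IsKernel.isHeatKernel_fourierKernel (hk : IsKernel k) :
    IsHeatKernel k (fourierKernel k) where
  initial := fourierKernel_zero k
  continuous_zero x y := (hk.hasDerivAt_fourierKernel 0 x y).continuousAt.continuousWithinAt
  equation t _ x y := by
    rw [hk.tsum_fourierKernel]
    exact hk.hasDerivAt_fourierKernel t x y
  bounded y _ := ⟨1, fun _ ht _ x => hk.abs_fourierKernel_le_one ht x y⟩

theorem integral_comp_natCast_mul_of_periodic {g : ℝ → ℝ} (hg : Continuous g)
    (hper : Function.Periodic g (2 * Real.pi)) {n : ℕ} (hn : n ≠ 0) :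
    ∫ θ in -Real.pi..Real.pi, g (n * θ) = ∫ θ in -Real.pi..Real.pi, g θ := by
  have hn0 : (n : ℝ) ≠ 0 := Nat.cast_ne_zero.2 hn
  rw [intervalIntegral.integral_comp_mul_left g hn0]
  have h := hper.intervalIntegral_add_zsmul_eq n (n * -Real.pi)
    (fun a b => hg.intervalIntegrable a b)
  have h1 : n * -Real.pi + (n : ℤ) • (2 * Real.pi) = n * Real.pi := by
    rw [zsmul_eq_mul]
    push_cast
    ring
  have h2 := hper.intervalIntegral_add_eq (n * -Real.pi) (-Real.pi)
  rw [h1, h2, show -Real.pi + 2 * Real.pi = Real.pi by ring, zsmul_eq_mul] at h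
  rw [h, smul_eq_mul]
  push_cast
  field_simp

theorem integral_exp_cos_le {b : ℝ} (hb : 0 < b) :
    ∫ θ in -Real.pi..Real.pi, Real.exp (-b * (1 - Real.cos θ)) ≤
      2 * Real.pi / Real.sqrt (2 * b) := by
  have hπ := Real.pi_pos
  have hc : 0 < 2 * b / Real.pi ^ 2 := by positivity
  have hle : -Real.pi ≤ Real.pi := by linarith
  calc ∫ θ in -Real.pi..Real.pi, Real.exp (-b * (1 - Real.cos θ))
      ≤ ∫ θ in -Real.pi..Real.pi, Real.exp (-(2 * b / Real.pi ^ 2) * θ ^ 2) := by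
        refine intervalIntegral.integral_mono_on hle
          (Continuous.intervalIntegrable (by fun_prop) _ _)
          (Continuous.intervalIntegrable (by fun_prop) _ _) fun θ hθ => ?_
        refine Real.exp_le_exp.2 ?_
        have h := Real.cos_le_one_sub_mul_cos_sq (abs_le.2 ⟨hθ.1, hθ.2⟩)
        have h2 : -(2 * b / Real.pi ^ 2) * θ ^ 2 = -(b * (2 / Real.pi ^ 2 * θ ^ 2)) := by ring
        rw [h2, neg_mul]
        exact neg_le_neg (mul_le_mul_of_nonneg_left (by linarith) hb.le)
    _ ≤ ∫ θ, Real.exp (-(2 * b / Real.pi ^ 2) * θ ^ 2) := by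
        rw [intervalIntegral.integral_of_le hle]
        exact MeasureTheory.setIntegral_le_integral (integrable_exp_neg_mul_sq hc)
          (Eventually.of_forall fun θ => (Real.exp_pos _).le)
    _ = Real.sqrt (Real.pi / (2 * b / Real.pi ^ 2)) := integral_gaussian _
    _ ≤ Real.sqrt ((2 * Real.pi) ^ 2 / (2 * b)) := by
        refine Real.sqrt_le_sqrt ?_
        have h4 := Real.pi_le_four
        rw [div_div_eq_mul_div]
        gcongr
        nlinarith [sq_nonneg Real.pi]
    _ = 2 * Real.pi / Real.sqrt (2 * b) := by
        rw [Real.sqrt_div (by positivity), Real.sqrt_sq (by positivity)]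

/-- On-diagonal decay: a single nonzero jump rate `k j` already forces `p_t ≤ (t k(j))^(-1/2)`. -/
theorem IsHeatKernel.le_one_div_sqrt {p : ℝ → ℤ → ℤ → ℝ} (hk : IsKernel k)
    (hp : IsHeatKernel k p) {j : ℤ} (hj : 0 < k j) {t : ℝ} (ht : 0 < t) (x y : ℤ) :
    p t x y ≤ 1 / Real.sqrt (t * k j) := by
  have hπ := Real.pi_pos
  have hj0 : j ≠ 0 := by
    rintro rfl
    exact hj.ne' hk.zero
  refine (hp.le_of_isHeatKernel hk hk.isHeatKernel_fourierKernel ht.le x y).trans ?_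
  have hb : 0 < 2 * (t * k j) := by positivity
  have hle : ∫ θ in -Real.pi..Real.pi, Real.exp (-t * symbol k θ) * Real.cos ((x - y) * θ) ≤
      2 * Real.pi / Real.sqrt (2 * (2 * (t * k j))) := by
    refine le_trans ?_ (integral_exp_cos_le hb)
    rw [← integral_comp_natCast_mul_of_periodic
      (g := fun θ => Real.exp (-(2 * (t * k j)) * (1 - Real.cos θ))) (by fun_prop)
      (fun θ => by simp only [Real.cos_add_two_pi]) (Int.natAbs_ne_zero.2 hj0)]
    refine intervalIntegral.integral_mono_on (by linarith)
      ((hk.continuous_fourier_integrand t _).intervalIntegrable _ _)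
      (Continuous.intervalIntegrable (by fun_prop) _ _) fun θ _ => ?_
    refine (mul_le_of_le_one_right (Real.exp_pos _).le (Real.cos_le_one _)).trans ?_
    refine Real.exp_le_exp.2 ?_
    have h := mul_le_mul_of_nonneg_left (hk.two_mul_le_symbol hj0 θ) ht.le
    have hcos : Real.cos ((j.natAbs : ℝ) * θ) = Real.cos (j * θ) := by
      rw [Nat.cast_natAbs, Int.cast_abs]
      rcases abs_choice (j : ℝ) with h | h <;> rw [h]
      rw [neg_mul, Real.cos_neg]
    rw [hcos]
    linarith
  calc fourierKernel k t x y
      ≤ (2 * Real.pi)⁻¹ * (2 * Real.pi / Real.sqrt (2 * (2 * (t * k j)))) :=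
        mul_le_mul_of_nonneg_left hle (by positivity)
    _ = 1 / Real.sqrt (2 * (2 * (t * k j))) := by field_simp
    _ ≤ 1 / Real.sqrt (t * k j) := by
        have : 0 < t * k j := by positivity
        exact one_div_le_one_div_of_le (Real.sqrt_pos.2 this) (Real.sqrt_le_sqrt (by linarith))

/-! ### A lower bound for the largest jump rate -/

theorem IsKernel.le_mass (hk : IsKernel k) (j : ℤ) : k j ≤ mass k :=
  hk.summable.le_tsum j fun _ _ => hk.nonneg _

theorem IsKernel.summable_sq (hk : IsKernel k) : Summable fun j => k j ^ 2 := by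
  refine Summable.of_norm_bounded (hk.summable.mul_right (mass k)) fun j => ?_
  rw [Real.norm_of_nonneg (sq_nonneg _), sq]
  exact mul_le_mul_of_nonneg_left (hk.le_mass j) (hk.nonneg j)

section TestFunction

theorem tsum_kernel_mul_ite (k : ℤ → ℝ) {H : ℝ → ℝ} (hH : H 0 = 0) (A : ℝ) {y : ℤ} (hy : y ≠ 0) :
    ∑' z, k (y - z) * H ((if z = 0 then A else 0) - if y = 0 then A else 0) = k y * H A := by
  rw [tsum_eq_single 0 fun z hz => by simp [hz, hy, hH]]
  simp [hy]

theorem IsKernel.tsum_kernel_mul_ite_zero (hk : IsKernel k) (H : ℝ → ℝ) (A : ℝ) :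
    ∑' z, k (0 - z) * H ((if z = 0 then A else 0) - if (0 : ℤ) = 0 then A else 0) =
      mass k * H (-A) := by
  rw [← tsum_kernel_sub k 0, ← tsum_mul_right]
  refine tsum_congr fun z => ?_
  rcases eq_or_ne z 0 with rfl | hz
  · simp [hk.zero]
  · simp [hz]

/-- Sums over the neighbours of `0` of expressions that are affine in `k`; the value at `0` itself
is irrelevant because `k 0 = 0`. -/
theorem IsKernel.tsum_mul_affine (hk : IsKernel k) {g : ℤ → ℝ} {a b : ℝ}
    (hg : ∀ y, y ≠ 0 → g y = a * k y + b) :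
    ∑' y, k (0 - y) * g y = a * ∑' y, k y ^ 2 + b * mass k := by
  rw [mass, ← tsum_mul_left, ← tsum_mul_left,
    ← (hk.summable_sq.mul_left a).tsum_add (hk.summable.mul_left b)]
  refine tsum_congr fun y => ?_
  rcases eq_or_ne y 0 with rfl | hy
  · simp [hk.zero]
  · rw [hg y hy, zero_sub, hk.symm]
    ring

/-- The condition `CD_Υ(0, F)` tested with `A` times the indicator function of `0`. -/
theorem CDUpsilon.le_of_indicator {F : ℝ → ℝ} (hk : IsKernel k) (hCD : CDUpsilon k F) {A : ℝ}
    (hA : 0 ≤ A) : F (A * mass k) ≤ ((∑' j, k j ^ 2) * Real.exp A + mass k ^ 2) / 2 := by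
  set u : ℤ → ℝ := fun z => if z = 0 then A else 0 with hu
  have hub : ∀ y, |u y| ≤ A := fun y => by
    simp only [hu]
    split_ifs <;> simp [abs_of_nonneg hA, hA]
  have hL0 : gen k u 0 = -(A * mass k) := by
    have := hk.tsum_kernel_mul_ite_zero id A
    simp only [id] at this
    rw [gen]
    simp only [hu, this]
    ring
  have hL : ∀ y, y ≠ 0 → gen k u y = k y * A := fun y hy =>
    tsum_kernel_mul_ite k (H := id) rfl A hy
  have hΨ0 : psi k upsilon u 0 = mass k * upsilon (-A) := hk.tsum_kernel_mul_ite_zero upsilon A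
  have hΨ : ∀ y, y ≠ 0 → psi k upsilon u y = k y * upsilon A := fun y hy =>
    tsum_kernel_mul_ite k (H := upsilon) (by simp [upsilon]) A hy
  have hLΨ : gen k (psi k upsilon u) 0 =
      upsilon A * ∑' j, k j ^ 2 + -(mass k * upsilon (-A)) * mass k :=
    hk.tsum_mul_affine fun y hy => by rw [hΨ y hy, hΨ0]; ring
  have hB : bForm k upsilonPrime u (gen k u) 0 =
      upsilonPrime (-A) * A * ∑' j, k j ^ 2 + upsilonPrime (-A) * (A * mass k) * mass k := by
    rw [← hk.tsum_mul_affine (g := fun y => upsilonPrime (u y - u 0) * (gen k u y - gen k u 0))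
      fun y hy => by rw [hL y hy, hL0]; simp [hu, hy]; ring]
    exact tsum_congr fun y => by ring
  have h := hCD u ⟨A, hub⟩ 0 (by rw [hL0, neg_neg]; exact mul_nonneg hA hk.mass_pos.le)
  rw [hL0, neg_neg, psiTwo, hLΨ, hB] at h
  refine h.trans (div_le_div_of_nonneg_right ?_ two_pos.le)
  have hS : 0 ≤ ∑' j, k j ^ 2 := tsum_nonneg fun j => sq_nonneg _
  have hE := Real.exp_pos (-A)
  have h1 : 0 ≤ (∑' j, k j ^ 2) * (1 + A * Real.exp (-A)) := by positivity
  have h2 : 0 ≤ mass k ^ 2 * (Real.exp (-A) * (1 + A)) := by positivity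
  unfold upsilon upsilonPrime
  linarith

end TestFunction

theorem mul_rpow_le_add {b s γ : ℝ} (hb : 0 < b) (hs : 0 < s) (hγ : 2 ≤ γ) :
    b * s ^ (1 - 2 / γ) ≤ s + b ^ (γ / 2) := by
  have hγ0 : 0 < γ := by linarith
  set r := max s (b ^ (γ / 2)) with hr
  have hr0 : 0 < r := lt_max_of_lt_left hs
  have h1 : b ≤ r ^ (2 / γ) := by
    have h := Real.rpow_le_rpow (by positivity) (le_max_right s (b ^ (γ / 2)))
      (by positivity : 0 ≤ 2 / γ)
    rwa [← Real.rpow_mul hb.le, div_mul_div_cancel₀ two_ne_zero, div_self hγ0.ne',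
      Real.rpow_one, ← hr] at h
  have h2 : s ^ (1 - 2 / γ) ≤ r ^ (1 - 2 / γ) :=
    Real.rpow_le_rpow hs.le (le_max_left _ _) (sub_nonneg.2 ((div_le_one hγ0).2 hγ))
  calc b * s ^ (1 - 2 / γ) ≤ r ^ (2 / γ) * r ^ (1 - 2 / γ) :=
        mul_le_mul h1 h2 (by positivity) (by positivity)
    _ = r := by
        rw [← Real.rpow_add hr0, add_sub_cancel, Real.rpow_one]
    _ ≤ s + b ^ (γ / 2) := max_le_add_of_nonneg hs.le (by positivity)

/-- Under `CD_Υ(0, F)` with `F(x) ≥ κ x^γ`, the total mass of the kernel cannot be spread too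
thinly: some jump rate is at least of the order `e^(-2 / |k|₁)`. -/
theorem CDUpsilon.exists_le_kernel {F : ℝ → ℝ} (hk : IsKernel k) (hCD : CDUpsilon k F) {κ γ : ℝ}
    (hκ : 0 < κ) (hγ : 2 ≤ γ) (hF : ∀ x, 0 ≤ x → κ * x ^ γ ≤ F x) :
    ∃ j, 1 ≤ k j * (2 * Real.exp (κ ^ (-(1 / 2) : ℝ)) * Real.exp (2 / mass k)) := by
  have hγ0 : 0 < γ := by linarith
  have hm := hk.mass_pos
  set m := mass k
  -- This `A` balances `κ (A m)^γ = m²`.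
  set A := κ ^ (-(1 / γ)) * (1 / m) ^ (1 - 2 / γ) with hA
  have hA0 : 0 < A := by positivity
  have hAm : κ * (A * m) ^ γ = m ^ 2 := by
    have h1 : A * m = κ ^ (-(1 / γ)) * m ^ (2 / γ) := by
      have h : (1 / m) ^ (1 - 2 / γ) * m = m ^ (2 / γ) := by
        rw [one_div, Real.inv_rpow hm.le, ← Real.rpow_neg hm.le]
        nth_rewrite 2 [← Real.rpow_one m]
        rw [← Real.rpow_add hm]
        congr 1
        ring
      rw [hA, mul_assoc, h]
    rw [h1, Real.mul_rpow (by positivity) (by positivity), ← Real.rpow_mul hκ.le,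
      ← Real.rpow_mul hm.le, div_mul_cancel₀ _ hγ0.ne', neg_mul, div_mul_cancel₀ _ hγ0.ne',
      Real.rpow_neg_one, ← mul_assoc, mul_inv_cancel₀ hκ.ne', one_mul, Real.rpow_two]
  have hsq : m ^ 2 ≤ (∑' j, k j ^ 2) * Real.exp A := by
    have h1 := hF (A * m) (by positivity)
    have h2 := hCD.le_of_indicator hk hA0.le
    rw [hAm] at h1
    linarith
  have hAle : A ≤ 1 / m + κ ^ (-(1 / 2) : ℝ) := by
    have h := mul_rpow_le_add (by positivity : 0 < κ ^ (-(1 / γ))) (one_div_pos.2 hm) hγ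
    rw [← Real.rpow_mul hκ.le, show -(1 / γ) * (γ / 2) = -(1 / 2) by field_simp] at h
    exact h
  obtain ⟨j, hj⟩ : ∃ j, m ≤ k j * (2 * Real.exp A) := by
    by_contra! hcon
    have h1 : ∀ j, k j ^ 2 ≤ k j * (m / (2 * Real.exp A)) := fun j => by
      rw [sq]
      exact mul_le_mul_of_nonneg_left ((le_div_iff₀ (by positivity)).2 (hcon j).le) (hk.nonneg j)
    have h2 := hk.summable_sq.tsum_le_tsum h1 (hk.summable.mul_right _)
    rw [tsum_mul_right, show ∑' j, k j = m from rfl] at h2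
    have h3 := hsq.trans (mul_le_mul_of_nonneg_right h2 (Real.exp_pos A).le)
    have h4 : m * (m / (2 * Real.exp A)) * Real.exp A = m ^ 2 / 2 := by field_simp
    rw [h4] at h3
    have := pow_pos hm 2
    linarith
  refine ⟨j, ?_⟩
  have hminv : 1 / m ≤ Real.exp (1 / m) := by linarith [Real.add_one_le_exp (1 / m)]
  have hkj := hk.nonneg j
  calc (1 : ℝ) = m * (1 / m) := by field_simp
    _ ≤ k j * (2 * Real.exp A) * (1 / m) := mul_le_mul_of_nonneg_right hj (by positivity)
    _ ≤ k j * (2 * Real.exp (1 / m + κ ^ (-(1 / 2) : ℝ))) * Real.exp (1 / m) := by gcongr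
    _ = k j * (2 * Real.exp (κ ^ (-(1 / 2) : ℝ)) * Real.exp (2 / m)) := by
        rw [show 2 / m = 1 / m + 1 / m by ring, Real.exp_add, Real.exp_add]
        ring

/-! ### The upper bound -/

theorem rpow_add_sub_rpow_le {a x q : ℝ} (ha : 0 < a) (hx : 0 ≤ x) (hx1 : x ≤ 1) (hq : 1 ≤ q) :
    (a + x) ^ q - x ^ q ≤ (a + 1) ^ q - 1 := by
  have hcv := convexOn_rpow hq
  have hd : 0 < a + 1 - x := by linarith
  -- Both `a + x` and `1` lie between `x` and `a + 1`, and the two pairs have the same sum.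
  have hμ : 0 ≤ a / (a + 1 - x) := by positivity
  have hμ' : 0 ≤ (1 - x) / (a + 1 - x) := div_nonneg (by linarith) hd.le
  have hxm := Set.mem_Ici.2 hx
  have ham := Set.mem_Ici.2 (by linarith : 0 ≤ a + 1)
  have e3 : (1 - x) / (a + 1 - x) + a / (a + 1 - x) = 1 := by
    field_simp
    ring
  have h1 := hcv.2 hxm ham hμ' hμ e3
  have h2 := hcv.2 hxm ham hμ hμ' ((add_comm _ _).trans e3)
  simp only [smul_eq_mul] at h1 h2
  have e1 : (1 - x) / (a + 1 - x) * x + a / (a + 1 - x) * (a + 1) = a + x := by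
    field_simp
    ring
  have e2 : a / (a + 1 - x) * x + (1 - x) / (a + 1 - x) * (a + 1) = 1 := by
    field_simp
    ring
  rw [e1] at h1
  rw [e2, Real.one_rpow] at h2
  have e4 : (1 - x) / (a + 1 - x) = 1 - a / (a + 1 - x) := by linarith
  rw [e4] at h1 h2
  linarith

theorem cTime_sub_le {γ t ν : ℝ} (hγ : 2 ≤ γ) (ht : 0 < t) (hν : 0 < ν) :
    cTime γ t ν - t ≤ (Real.exp ν - 1) * max t 1 := by
  have hE : 0 ≤ Real.exp ν - 1 := by linarith [Real.add_one_le_exp ν]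
  rcases eq_or_lt_of_le hγ with rfl | hγ2
  · rw [cTime, if_pos rfl]
    calc Real.exp ν * t - t = (Real.exp ν - 1) * t := by ring
      _ ≤ _ := mul_le_mul_of_nonneg_left (le_max_left _ _) hE
  have hγ1 : 0 < γ - 1 := by linarith
  set β := (γ - 2) / (γ - 1) with hβ
  have hβ0 : 0 < β := div_pos (by linarith) hγ1
  have hβ1 : 1 ≤ β⁻¹ := (one_le_inv₀ hβ0).2 ((div_le_one hγ1).2 (by linarith))
  have hc : cTime γ t ν = (β * ν + t ^ β) ^ β⁻¹ := by
    rw [cTime, if_neg hγ2.ne', ← hβ, ← inv_div, ← hβ]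
  have htβ : (t ^ β) ^ β⁻¹ = t := Real.rpow_rpow_inv ht.le hβ0.ne'
  have hexp : (β * ν + 1) ^ β⁻¹ ≤ Real.exp ν := by
    calc (β * ν + 1) ^ β⁻¹ ≤ Real.exp (β * ν) ^ β⁻¹ :=
          Real.rpow_le_rpow (by positivity) (Real.add_one_le_exp _) (by positivity)
      _ = Real.exp ν := by
          rw [← Real.exp_mul]
          congr 1
          field_simp
  rw [hc]
  rcases le_total 1 t with h | h
  · rw [max_eq_left h]
    have h1 : β * ν + t ^ β ≤ (β * ν + 1) * t ^ β := by
      have := Real.one_le_rpow h hβ0.le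
      nlinarith [mul_pos hβ0 hν]
    have h2 : (β * ν + t ^ β) ^ β⁻¹ ≤ Real.exp ν * t := by
      calc (β * ν + t ^ β) ^ β⁻¹ ≤ ((β * ν + 1) * t ^ β) ^ β⁻¹ :=
            Real.rpow_le_rpow (by positivity) h1 (by positivity)
        _ = (β * ν + 1) ^ β⁻¹ * t := by
            rw [Real.mul_rpow (by positivity) (by positivity), htβ]
        _ ≤ Real.exp ν * t := mul_le_mul_of_nonneg_right hexp ht.le
    linarith
  · rw [max_eq_right h, mul_one]
    have h1 := rpow_add_sub_rpow_le (mul_pos hβ0 hν) (Real.rpow_nonneg ht.le β)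
      (Real.rpow_le_one ht.le h hβ0.le) hβ1
    rw [htβ] at h1
    linarith

/-- The constant `4 D`, where `D e^(4 / |k|₁) / t` bounds `p_t²` under `CD_Υ(0, F)` with
`F(x) ≥ c e² x^γ / 2`. -/
noncomputable def decayConst (c : ℝ) : ℝ :=
  4 * (2 * Real.exp ((c * Real.exp 2 / 2) ^ (-(1 / 2) : ℝ)))

theorem decayConst_pos (c : ℝ) : 0 < decayConst c := by
  unfold decayConst
  positivity

theorem four_le_decayConst {c : ℝ} (hc : 0 < c) : 4 ≤ decayConst c := by
  have h : 0 < (c * Real.exp 2 / 2) ^ (-(1 / 2) : ℝ) := by positivity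
  have h2 := Real.one_le_exp h.le
  unfold decayConst
  linarith

theorem Dominates.four_mul_sq_mul_max_le {c γ δ : ℝ} {F : ℝ → ℝ} (hdom : Dominates F c γ δ)
    (hc : 0 < c) (hγ : 2 ≤ γ) (hk : IsKernel k) (hCD : CDUpsilon k F) {p : ℝ → ℤ → ℤ → ℝ}
    (hp : IsHeatKernel k p) {t : ℝ} (ht : 0 < t) (x y : ℤ) :
    4 * p t x y ^ 2 * max t 1 ≤ decayConst c * Real.exp (2 / mass k) ^ 2 := by
  have hm := hk.mass_pos
  have hp0 := hp.nonneg hk ht.le x y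
  have hE1 : 1 ≤ Real.exp (2 / mass k) := Real.one_le_exp (by positivity)
  rcases le_total 1 t with h | h
  · obtain ⟨j, hj⟩ := hCD.exists_le_kernel hk (by positivity : 0 < c * Real.exp 2 / 2) hγ
      hdom.rpow_le
    have hkj : 0 < k j := by
      refine lt_of_le_of_ne (hk.nonneg j) fun h0 => ?_
      rw [← h0, zero_mul] at hj
      linarith
    have h1 : p t x y ^ 2 ≤ 1 / (t * k j) := by
      have h := pow_le_pow_left₀ hp0 (hp.le_one_div_sqrt hk hkj ht x y) 2
      rwa [div_pow, one_pow, Real.sq_sqrt (by positivity)] at h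
    have h2 : p t x y ^ 2 * t ≤ 1 / k j := by
      calc p t x y ^ 2 * t ≤ 1 / (t * k j) * t := mul_le_mul_of_nonneg_right h1 ht.le
        _ = 1 / k j := by field_simp
    have h3 : 1 / k j ≤ 2 * Real.exp ((c * Real.exp 2 / 2) ^ (-(1 / 2) : ℝ)) *
        Real.exp (2 / mass k) := by
      rw [div_le_iff₀ hkj]
      linarith
    rw [max_eq_left h]
    have h4 := decayConst_pos c
    calc 4 * p t x y ^ 2 * t = 4 * (p t x y ^ 2 * t) := by ring
      _ ≤ 4 * (2 * Real.exp ((c * Real.exp 2 / 2) ^ (-(1 / 2) : ℝ)) *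
          Real.exp (2 / mass k)) := by linarith
      _ = decayConst c * Real.exp (2 / mass k) := by rw [decayConst]; ring
      _ ≤ decayConst c * Real.exp (2 / mass k) ^ 2 :=
          mul_le_mul_of_nonneg_left (le_self_pow₀ hE1 two_ne_zero) h4.le
  · rw [max_eq_right h, mul_one]
    have h1 : p t x y ^ 2 ≤ 1 := pow_le_one₀ hp0 (hp.le_one hk ht.le x y)
    have h2 := four_le_decayConst hc
    have h3 : 1 ≤ Real.exp (2 / mass k) ^ 2 := one_le_pow₀ hE1
    nlinarith

theorem Dominates.le_exp_div {c γ δ : ℝ} {F : ℝ → ℝ} (hdom : Dominates F c γ δ)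
    (hc : 0 < c) (hγ : 2 ≤ γ) (hk : IsKernel k) (hCD : CDUpsilon k F) {p : ℝ → ℤ → ℤ → ℝ}
    (hp : IsHeatKernel k p) {t : ℝ} (ht : 0 < t) (x y : ℤ) {ν : ℝ} (hν : 0 < ν)
    (hτ : 1 ≤ cTime γ t ν - t) :
    p t x y ≤ Real.exp ((decayConst c + 1) / 2 * ν + 2 / mass k) /
      (2 * (⌊Real.sqrt (cTime γ t ν - t)⌋ : ℝ)) := by
  have hp0 := hp.nonneg hk ht.le x y
  have hD := decayConst_pos c
  have hfloor : (1 : ℝ) ≤ ⌊Real.sqrt (cTime γ t ν - t)⌋ := by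
    exact_mod_cast Int.le_floor.2 (by simpa using hτ)
  rw [le_div_iff₀ (by linarith)]
  have h1 : p t x y * (2 * (⌊Real.sqrt (cTime γ t ν - t)⌋ : ℝ)) ≤
      p t x y * (2 * Real.sqrt (cTime γ t ν - t)) := by
    gcongr
    exact Int.floor_le _
  refine h1.trans (le_of_sq_le_sq ?_ (Real.exp_pos _).le)
  have hE : 0 ≤ Real.exp ν - 1 := by linarith [Real.add_one_le_exp ν]
  -- `e^ν - 1 ≤ ν e^ν`, so a large multiple of `ν` in the exponent absorbs the factor `4 D`.
  have hν1 : decayConst c * (Real.exp ν - 1) ≤ Real.exp ((decayConst c + 1) * ν) := by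
    have h2 : Real.exp ν - 1 ≤ ν * Real.exp ν := by
      have h := Real.add_one_le_exp (-ν)
      have h3 := mul_le_mul_of_nonneg_right h (Real.exp_pos ν).le
      rw [← Real.exp_add, neg_add_cancel, Real.exp_zero] at h3
      linarith
    calc decayConst c * (Real.exp ν - 1) ≤ decayConst c * (ν * Real.exp ν) :=
          mul_le_mul_of_nonneg_left h2 hD.le
      _ = decayConst c * ν * Real.exp ν := by ring
      _ ≤ Real.exp (decayConst c * ν) * Real.exp ν :=
          mul_le_mul_of_nonneg_right (by linarith [Real.add_one_le_exp (decayConst c * ν)])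
            (Real.exp_pos ν).le
      _ = Real.exp ((decayConst c + 1) * ν) := by rw [← Real.exp_add]; ring_nf
  calc (p t x y * (2 * Real.sqrt (cTime γ t ν - t))) ^ 2
      = 4 * p t x y ^ 2 * (cTime γ t ν - t) := by
        rw [mul_pow, mul_pow, Real.sq_sqrt (by linarith)]
        ring
    _ ≤ 4 * p t x y ^ 2 * ((Real.exp ν - 1) * max t 1) :=
        mul_le_mul_of_nonneg_left (cTime_sub_le hγ ht hν) (by positivity)
    _ = 4 * p t x y ^ 2 * max t 1 * (Real.exp ν - 1) := by ring
    _ ≤ decayConst c * Real.exp (2 / mass k) ^ 2 * (Real.exp ν - 1) :=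
        mul_le_mul_of_nonneg_right (hdom.four_mul_sq_mul_max_le hc hγ hk hCD hp ht x y) hE
    _ = decayConst c * (Real.exp ν - 1) * Real.exp (2 / mass k) ^ 2 := by ring
    _ ≤ Real.exp ((decayConst c + 1) * ν) * Real.exp (2 / mass k) ^ 2 :=
        mul_le_mul_of_nonneg_right hν1 (by positivity)
    _ = Real.exp ((decayConst c + 1) / 2 * ν + 2 / mass k) ^ 2 := by
        rw [← Real.exp_nat_mul, ← Real.exp_nat_mul, ← Real.exp_add]
        congr 1
        push_cast
        ring

end LongRange

theorem mainTheorem8 :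
    ∃ τ₁ τ₂ C₀ : ℝ → ℝ → ℝ → ℝ,
      (∀ c γ δ : ℝ, 0 < c → 2 ≤ γ → 0 < δ → 0 < C₀ c γ δ) ∧
      ∀ (F : ℝ → ℝ) (γ δ c₁ c₂ : ℝ), LongRange.IsCDFunction F →
        2 ≤ γ → 0 < δ → 0 < c₁ → 0 < c₂ →
        F ~[𝓝[>] 0] (fun x => c₁ * x ^ γ) →
        F ~[atTop] (fun x => c₂ * Real.exp (δ * x)) →
        ∃ c : ℝ, 0 < c ∧
          (∀ t : ℝ, 0 < t → 0 < LongRange.Lam c γ δ (τ₁ c γ δ) (τ₂ c γ δ) t) ∧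
          ∀ (k : ℤ → ℝ) (α : ℝ), LongRange.IsKernel k → 0 < α →
            LongRange.HasFiniteMoment k α → LongRange.CDUpsilon k F →
            ∀ p : ℝ → ℤ → ℤ → ℝ, LongRange.IsHeatKernel k p →
              ∀ t : ℝ, 0 < t → ∀ x y : ℤ,
                (0 < k 1 →
                  Real.exp (-(LongRange.Lam c γ δ (τ₁ c γ δ) (τ₂ c γ δ) t +
                    2 * |(x : ℝ) - (y : ℝ)| ^ 2 / (k 1 * t))) ≤ p t x y) ∧
                ∀ ν : ℝ, 0 < ν → 1 ≤ LongRange.cTime γ t ν - t →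
                  p t x y ≤ Real.exp (C₀ c γ δ * ν + 2 / LongRange.mass k) /
                    (2 * (⌊Real.sqrt (LongRange.cTime γ t ν - t)⌋ : ℝ)) := by
  refine ⟨LongRange.lamShift, LongRange.lamShift, fun c _ _ => (LongRange.decayConst c + 1) / 2,
    fun c _ _ _ _ _ => by have := LongRange.decayConst_pos c; positivity, ?_⟩
  intro F γ δ c₁ c₂ hF hγ hδ hc₁ hc₂ h0 hinf
  obtain ⟨c, hc, hdom⟩ := hF.exists_dominates (by linarith) hδ hc₁ hc₂ h0 hinf
  refine ⟨c, hc, fun t ht => LongRange.Lam_pos hc hγ hδ ht, ?_⟩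
  intro k _ hk _ _ hCD p hp t ht x y
  exact ⟨fun h1 => hdom.exp_neg_Lam_le hc hγ hδ hk hF hCD hp h1 ht x y,
    fun ν hν hτ => hdom.le_exp_div hc hγ hk hCD hp ht x y hν hτ⟩
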